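/- Let $n\ge 1$ and $\mathbb{HP}^n=U(n+1,\mathbb H)/(U(1,\mathbb H)\times U(n,\mathbb H))$, $\chi=8(n+2)$, and let $\langle\mathbf a,\mathbf b\rangle=\mathbf a\bar{\mathbf b}^{\rm t}$ on $\mathbb H^{n-1}$. Write $\mathfrak u(n+1,\mathbb H)=\mathfrak h\oplus\mathfrak m$ for the symmetric decomposition. With matrices in blocks of sizes $1,1,n-1$, let $(m,\mathbf m)\in\mathfrak m$ be the skew-Hermitian matrix with first row $(0,m,\mathbf m)$ and lower right block $0$, and for $u\in\operatorname{Im}\mathbb H$, $\mathbf u\in\mathbb H^{n-1}$ let $$(u,\mathbf u)=\begin{pmatrix}u&0&0\\0&-u&\mathbf u\\0&-\bar{\mathbf u}^{\rm t}&0\end{pmatrix}\in\mathfrak h_\perp .$$ Operators. For scalars $u,v$, vectors $\mathbf u,\mathbf v$ and matrices $\mathbf V\in\mathfrak u(n-1,\mathbb H)$ let $C_uv=uv-vu$, $A_uv=uv+vu$, $C_{\mathbf u}\mathbf v=\frac12(\langle\mathbf u,\mathbf v\rangle-\langle\mathbf v,\mathbf u\rangle)$, $A_{\mathbf u}\mathbf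 v=\frac12(\langle\mathbf u,\mathbf v\rangle+\langle\mathbf v,\mathbf u\rangle)$, $\mathbf C_{\mathbf u}\mathbf v=\bar{\mathbf u}^{\rm t}\mathbf v-\bar{\mathbf v}^{\rm t}\mathbf u$, $R_{\mathbf u}v=v\mathbf u$, $L_u\mathbf v=u\mathbf v$, $L_{\mathbf u}\mathbf V=\mathbf u\mathbf V$, and $$\mathcal H=\begin{pmatrix}D_x-C_uD_x^{-1}C_u & C_{\mathbf u}+C_uD_x^{-1}C_{\mathbf u}\\ R_{\mathbf u}D_x^{-1}C_u+R_{\mathbf u} & D_x-R_{\mathbf u}D_x^{-1}C_{\mathbf u}+L_{\mathbf u}D_x^{-1}\mathbf C_{\mathbf u}-L_u\end{pmatrix},$$ $$\mathcal J=\begin{pmatrix}\frac14D_x-\frac14A_uD_x^{-1}A_u & \frac12C_{\mathbf u}+\frac12A_uD_x^{-1}A_{\mathbf u}\\ \frac12R_{\mathbf u}-\frac12R_{\mathbf u}D_x^{-1}A_u & D_x+L_u+R_{\mathbf u}D_x^{-1}A_{\mathbf u}\end{pmatrix}.$$ Here $D_x^{-1}f$ denotes a solution $p$ of $D_xp=f$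 with $p$ in the same space ($\mathbb R$, $\operatorname{Im}\mathbb H$ or $\mathfrak u(n-1,\mathbb H)$) as $f$; the terms containing $D_x^{-1}$ are collected by linearity, and statements hold for every choice of $p$ unless a particular one is asserted to exist. An inverse operator is the inverse relation. (1) Flow. Let $\gamma(t,x)\in\mathbb{HP}^n$ be a non-stretching curve flow on an open set of the $(t,x)$-plane, with a smooth moving frame $g(t,x)\in U(n+1,\mathbb H)$ over $\gamma$, so that the pulled-back coframe $e$ and connection $\omega$ are the $\mathfrak m$- and $\mathfrak h$-parts of $g^{-1}dg$. Suppose that the frame is parallel: $e_x=\chi^{-1/2}(1,\mathbf 0)$ and $\omega_x=(u,\mathbf u)\in\mathfrak h_\perp$. Let $w=(w^\perp,\mathbf w^\perp)$ be the $\mathfrak h_\perp$-part of $\omega_t$, let $(h_\perp,\mathbf h_\perp)$ be the part of $e_t$ orthogonal to $e_x$, and put $h=\sqrt\chi\,(2h_\perp,-\mathbf h_\perp)$. Then, for suitable choices of $D_x^{-1}$, $$\begin{pmatrix}u_t\\\mathbf u_t\end{pmatrix}=\mathcal H(w)+\chi^{-1}h,\qquad w=\mathcal J(h).$$ (2) Bi-Hamiltonian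 structure. Consider the $x$-jet space of $(u,\mathbf u)$, possibly enlarged by nonlocal variables: a commutative real differential algebra with total derivative $D_x$ and a Lie algebra of prolonged vector fields, i.e. of derivations $X$ commuting with $D_x$. Functionals $\int H\,dx$ are densities modulo total $x$-derivatives, and $\delta\mathfrak F=(-\delta\mathfrak F/\delta u,\ \delta\mathfrak F/\delta\bar{\mathbf u})$ is defined by $X\mathfrak F=\operatorname{Re}\int\langle\delta\mathfrak F,X(u,\mathbf u)\rangle dx$ for all $X$. Let $\mathcal P$ be an operator on scalar-vector pairs. It is *Hamiltonian (cosymplectic)* if the bracket $\{\mathfrak F,\mathfrak G\}=\operatorname{Re}\int\langle\delta\mathfrak F,\mathcal P\,\delta\mathfrak G\rangle dx$ is skew-symmetric and satisfies the Jacobi identity for all functionals that have a variational derivative and a Hamiltonian vector field $X_{\mathfrak F}$, $X_{\mathfrak F}(u,\mathbf u)=\mathcal P\,\delta\mathfrak F$, on the given space, where $\{\mathfrak L,\mathfrak K\}=X_{\mathfrak K}\mathfrak L$ for $\mathfrak L=\{\mathfrak F,\mathfrak G\}$. It is *symplectic* if $\boldsymbol\omega(X_1,X_2)=\operatorname{Re}\int\langle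 X_1(u,\mathbf u),\mathcal P\,X_2(u,\mathbf u)\rangle dx$ is skew-symmetric and closed. On all such spaces, $\mathcal H$ is a Hamiltonian cosymplectic operator, $\mathcal J$ is a symplectic operator, and the two are compatible: for all $c_1,c_2\in\mathbb R$ the operator $c_1\mathcal H+c_2\mathcal J^{-1}$ is Hamiltonian cosymplectic and $c_1\mathcal H^{-1}+c_2\mathcal J$ is symplectic. -/

import Mathlib

open scoped Quaternion ContDiff

universe v

noncomputable section

/-! ## Quaternions over a commutative real algebra

A quaternion-valued differential function is a quaternion whose four real components lie in a
commutative real algebra `A` of real-valued functions. -/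

section Quaternionic

variable (n : ℕ) (A : Type v) [CommRing A] [Algebra ℝ A]

/-- Imaginary quaternions. -/
def imH : Submodule ℝ ℍ[A] where
  carrier := {q | q.re = 0}
  add_mem' := by
    intro a b ha hb
    simp only [Set.mem_ofPred_eq] at ha hb ⊢
    simp [ha, hb]
  zero_mem' := by simp
  smul_mem' := by
    intro c a ha
    simp only [Set.mem_ofPred_eq] at ha ⊢
    simp [ha]

/-- Scalar-vector pairs: an imaginary quaternion together with a quaternionic vector with `n - 1`
components. -/
abbrev QField : Type v := imH A × (Fin (n - 1) → ℍ[A])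

variable {n A}

/-- The imaginary part of a quaternion. -/
def imPart (q : ℍ[A]) : imH A := ⟨⟨0, q.imI, q.imJ, q.imK⟩, rfl⟩

/-- The action of a derivation of `A` on quaternions, componentwise. -/
def dQ (D : Derivation ℝ A A) (q : ℍ[A]) : ℍ[A] := ⟨D q.re, D q.imI, D q.imJ, D q.imK⟩

/-- The action of a derivation of `A` on imaginary quaternions. -/
def dIm (D : Derivation ℝ A A) (q : imH A) : imH A :=
  ⟨dQ D q.1, by
    have h : (q : ℍ[A]).re = 0 := q.2
    change D (q : ℍ[A]).re = 0
    rw [h, map_zero]⟩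

/-- The action of a derivation of `A` on scalar-vector pairs, componentwise. -/
def dField (D : Derivation ℝ A A) (w : QField n A) : QField n A :=
  (dIm D w.1, fun i => dQ D (w.2 i))

/-- The action of a derivation of `A` on quaternionic matrices, entrywise. -/
def dMat {ι : Type*} (D : Derivation ℝ A A) (M : Matrix ι ι ℍ[A]) : Matrix ι ι ℍ[A] :=
  M.map (dQ D)

/-- The Hermitian product `<a, b>`, the sum of the `aᵢ b̄ᵢ`. -/
def herm (a b : Fin (n - 1) → ℍ[A]) : ℍ[A] := ∑ i, a i * star (b i)

/-- The Euclidean pairing `Re (a b̄ + <𝐚, 𝐛>)` of scalar-vector pairs. -/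
def pairing (a b : QField n A) : A :=
  ((a.1 : ℍ[A]) * star (b.1 : ℍ[A]) + herm a.2 b.2).re

/-- The scalar commutator operator `C_u v = u v - v u`. -/
def opC (u v : ℍ[A]) : ℍ[A] := u * v - v * u

/-- The scalar anticommutator operator `A_u v = u v + v u`. -/
def opA (u v : ℍ[A]) : ℍ[A] := u * v + v * u

/-- The vector commutator operator `C_𝐮 𝐯 = ½ (<𝐮, 𝐯> - <𝐯, 𝐮>)`. -/
def opCv (u v : Fin (n - 1) → ℍ[A]) : ℍ[A] := (1 / 2 : ℝ) • (herm u v - herm v u)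

/-- The vector anticommutator operator `A_𝐮 𝐯 = ½ (<𝐮, 𝐯> + <𝐯, 𝐮>)`. -/
def opAv (u v : Fin (n - 1) → ℍ[A]) : ℍ[A] := (1 / 2 : ℝ) • (herm u v + herm v u)

/-- The matrix commutator operator `𝐂_𝐮 𝐯 = 𝐮̄ᵗ 𝐯 - 𝐯̄ᵗ 𝐮`. -/
def opCm (u v : Fin (n - 1) → ℍ[A]) : Matrix (Fin (n - 1)) (Fin (n - 1)) ℍ[A] :=
  fun i j => star (u i) * v j - star (v i) * u j

/-- Right multiplication `R_𝐮 v = v 𝐮` of a scalar by a vector. -/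
def opR (u : Fin (n - 1) → ℍ[A]) (v : ℍ[A]) : Fin (n - 1) → ℍ[A] := fun i => v * u i

/-- Left multiplication `L_u 𝐯 = u 𝐯` of a vector by a scalar. -/
def opL (u : ℍ[A]) (v : Fin (n - 1) → ℍ[A]) : Fin (n - 1) → ℍ[A] := fun i => u * v i

/-- Left multiplication `L_𝐮 𝐕 = 𝐮 𝐕` of a matrix by a row vector. -/
def opLm (u : Fin (n - 1) → ℍ[A]) (V : Matrix (Fin (n - 1)) (Fin (n - 1)) ℍ[A]) :
    Fin (n - 1) → ℍ[A] := Matrix.vecMul u V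

/-- `v = 𝓗 w`, where, with `D = D_x`,

`𝓗 = [ D - C_u D⁻¹ C_u          C_𝐮 + C_u D⁻¹ C_𝐮                    ]`
`    [ R_𝐮 D⁻¹ C_u + R_𝐮        D - R_𝐮 D⁻¹ C_𝐮 + L_𝐮 D⁻¹ 𝐂_𝐮 - L_u ]`.

The formal inverse `D⁻¹ f` stands for a solution `p` of `D p = f` in the space in which `f` lives:
here `p = D⁻¹ (C_u w - C_𝐮 𝐰)` is an imaginary quaternion and `V = D⁻¹ 𝐂_𝐮 𝐰` is a quaternionic
skew-Hermitian matrix. -/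
def hamRel (D : Derivation ℝ A A) (u w v : QField n A) : Prop :=
  ∃ (p : imH A) (V : Matrix (Fin (n - 1)) (Fin (n - 1)) ℍ[A]),
    V.conjTranspose = -V ∧
    dQ D p = opC u.1 w.1 - opCv u.2 w.2 ∧
    dMat D V = opCm u.2 w.2 ∧
    (v.1 : ℍ[A]) = dQ D w.1 - opC u.1 p + opCv u.2 w.2 ∧
    v.2 = opR u.2 p + opR u.2 w.1 + (fun i => dQ D (w.2 i)) + opLm u.2 V - opL u.1 w.2

/-- `w = 𝓙 h`, where, with `D = D_x`,

`𝓙 = [ ¼ D - ¼ A_u D⁻¹ A_u          ½ C_𝐮 + ½ A_u D⁻¹ A_𝐮      ]`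
`    [ ½ R_𝐮 - ½ R_𝐮 D⁻¹ A_u        D + L_u + R_𝐮 D⁻¹ A_𝐮      ]`.

Here `r = D⁻¹ (½ A_u h - A_𝐮 𝐡)` is real. -/
def sympRel (D : Derivation ℝ A A) (u h w : QField n A) : Prop :=
  ∃ r : A,
    ((D r : A) : ℍ[A]) = (1 / 2 : ℝ) • opA u.1 h.1 - opAv u.2 h.2 ∧
    (w.1 : ℍ[A]) = (1 / 4 : ℝ) • dQ D h.1 + (1 / 2 : ℝ) • opCv u.2 h.2
      - (1 / 2 : ℝ) • opA u.1 (r : ℍ[A]) ∧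
    w.2 = (1 / 2 : ℝ) • opR u.2 h.1 + (fun i => dQ D (h.2 i)) + opL u.1 h.2
      - opR u.2 (r : ℍ[A])

end Quaternionic

/-! ## Jet spaces, functionals, and Hamiltonian and symplectic operators -/

/-- The differential algebra of real-valued functions on the `x`-jet space of the scalar-vector
variable `u`, possibly enlarged by nonlocal variables. It carries the total derivative `D`, the
variable `u` (the jet coordinates are the `D^k u`), and a Lie algebra `vf` of prolonged evolutionary
vector fields: derivations that commute with `D`. The vector field `X` is the prolongation of
`X u · ∂/∂u`.

On the local jet space itself `vf` consists of the prolongations of all evolutionary vector fields.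
Since `D⁻¹` of a local function is in general not a function on the local jet space, such nonlocal
functions are adjoined to the algebra as further elements, to which the vector fields extend. -/
structure JetAlgebra (n : ℕ) where
  /-- The algebra of (differential or nonlocal) functions. -/
  carrier : Type v
  [ring : CommRing carrier]
  [alg : Algebra ℝ carrier]
  /-- The total `x`-derivative. -/
  D : Derivation ℝ carrier carrier
  /-- The field variable. -/
  u : QField n carrier
  /-- The prolonged evolutionary vector fields. -/
  vf : LieSubalgebra ℝ (Derivation ℝ carrier carrier)
  /-- Prolonged vector fields commute with the total derivative. -/
  vf_comm : ∀ X ∈ vf, ∀ a, X (D a) = D (X a)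

attribute [instance] JetAlgebra.ring JetAlgebra.alg

/-- Real coordinates of a scalar-vector pair: three for the imaginary scalar, four for each
component of the vector. -/
abbrev Coord (n : ℕ) : Type := Fin 3 ⊕ (Fin (n - 1) × Fin 4)

/-- Differential polynomials: polynomials in `x` (the variable `none`) and in the jet coordinates
`D^k u^c` (the variables `some (k, c)`). -/
abbrev DiffPoly (n : ℕ) : Type := MvPolynomial (Option (ℕ × Coord n)) ℝ

/-- The total derivative of differential polynomials. -/
def totalD (n : ℕ) : Derivation ℝ (DiffPoly n) (DiffPoly n) :=
  MvPolynomial.mkDerivation ℝ fun v => match v with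
    | none => 1
    | some (k, c) => MvPolynomial.X (some (k + 1, c))

/-- The basic example: the local jet space `(x, u, u_x, u_xx, …)` with polynomial functions and all
prolonged evolutionary vector fields. -/
def localJets (n : ℕ) : JetAlgebra.{0} n where
  carrier := DiffPoly n
  D := totalD n
  u :=
    (⟨⟨0, MvPolynomial.X (some (0, Sum.inl 0)), MvPolynomial.X (some (0, Sum.inl 1)),
        MvPolynomial.X (some (0, Sum.inl 2))⟩, rfl⟩,
      fun i => ⟨MvPolynomial.X (some (0, Sum.inr (i, 0))), MvPolynomial.X (some (0, Sum.inr (i, 1))),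
        MvPolynomial.X (some (0, Sum.inr (i, 2))), MvPolynomial.X (some (0, Sum.inr (i, 3)))⟩)
  vf :=
    { carrier := {X | X (MvPolynomial.X none) = 0 ∧ ∀ a, X (totalD n a) = totalD n (X a)}
      zero_mem' := by simp
      add_mem' := by
        intro X Y hX hY
        simp only [Set.mem_ofPred_eq] at hX hY ⊢
        exact ⟨by simp [hX.1, hY.1], fun a => by simp [hX.2, hY.2]⟩
      smul_mem' := by
        intro c X hX
        simp only [Set.mem_ofPred_eq] at hX ⊢
        exact ⟨by simp [hX.1], fun a => by simp [hX.2]⟩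
      lie_mem' := by
        intro X Y hX hY
        refine ⟨?_, fun a => ?_⟩
        · rw [Derivation.commutator_apply, hX.1, hY.1, map_zero, map_zero, sub_zero]
        · rw [Derivation.commutator_apply, Derivation.commutator_apply, hX.2, hY.2, hX.2, hY.2,
            map_sub] }
  vf_comm := fun _ hX => hX.2

namespace JetAlgebra

variable {n : ℕ} (J : JetAlgebra.{v} n)

/-- Scalar-vector pairs of functions on the jet space. -/
abbrev Field : Type v := QField n J.carrier

/-- Functionals `∫ H dx`: densities modulo total `x`-derivatives. -/
abbrev Functional : Type v := J.carrier ⧸ LinearMap.range J.D.toLinearMap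

/-- The functional `∫ H dx` with density `H`. -/
def integral (H : J.carrier) : J.Functional := Submodule.Quotient.mk H

/-- The components `X u` of a vector field `X`. -/
def comps (X : J.vf) : J.Field := dField X.1 J.u

/-- The variation of a functional under a vector field: `∫ H dx ↦ ∫ X H dx`. -/
def act (X : J.vf) : J.Functional →ₗ[ℝ] J.Functional :=
  Submodule.mapQ _ _ X.1.toLinearMap (by
    rintro _ ⟨a, rfl⟩
    exact ⟨X.1 a, (J.vf_comm X.1 X.2 a).symm⟩)

/-- `w` is the variational derivative of the functional `F`, as a gradient for the Euclidean
pairing: `w = (-δF/δu, δF/δ𝐮̄)`. -/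
def IsVarDeriv (F : J.Functional) (w : J.Field) : Prop :=
  ∀ X : J.vf, J.act X F = J.integral (pairing w (J.comps X))

end JetAlgebra

/-- Nonlocal operators on scalar-vector pairs of functions on the jet space, given through their
graphs: `P J w v` means `v = P w`. -/
def NonlocalOp (n : ℕ) : Type (v + 1) := ∀ J : JetAlgebra.{v} n, J.Field → J.Field → Prop

namespace NonlocalOp

variable {n : ℕ}

/-- The formal inverse operator. -/
def inverse (P : NonlocalOp.{v} n) : NonlocalOp.{v} n := fun J w v => P J v w

/-- The linear combination `c₁ P + c₂ Q`. -/
def comb (c₁ c₂ : ℝ) (P Q : NonlocalOp.{v} n) : NonlocalOp.{v} n := fun J w v =>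
  ∃ v₁ v₂ : J.Field, P J w v₁ ∧ Q J w v₂ ∧ v = c₁ • v₁ + c₂ • v₂

/-- A functional `𝔉` with its variational derivative `δ𝔉` and its Hamiltonian vector field, the
prolonged vector field with components `P δ𝔉`. -/
structure HamFunctional (P : NonlocalOp.{v} n) (J : JetAlgebra.{v} n) where
  /-- The functional. -/
  val : J.Functional
  /-- Its variational derivative. -/
  grad : J.Field
  isVarDeriv : J.IsVarDeriv val grad
  /-- Its Hamiltonian vector field. -/
  vec : J.vf
  vec_eq : P J grad (J.comps vec)

/-- The Poisson bracket `{𝔉, 𝔊} = Re ∫ <δ𝔉, P δ𝔊> dx`. -/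
def poisson {P : NonlocalOp.{v} n} {J : JetAlgebra.{v} n} (F G : HamFunctional P J) :
    J.Functional :=
  J.integral (pairing F.grad (J.comps G.vec))

/-- `P` is a Hamiltonian cosymplectic operator: its Poisson bracket is skew-symmetric and satisfies
the Jacobi identity. The bracket `{𝔏, 𝔎} = Re ∫ <δ𝔏, P δ𝔎> dx` of `𝔏 = {𝔉, 𝔊}` with `𝔎` is the
variation of `𝔏` under the Hamiltonian vector field of `𝔎`. -/
def IsHamiltonian (P : NonlocalOp.{v} n) : Prop :=
  ∀ J : JetAlgebra.{v} n,
    (∀ F G : HamFunctional P J, poisson F G = -poisson G F) ∧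
    (∀ F G K : HamFunctional P J,
      J.act K.vec (poisson F G) + J.act F.vec (poisson G K) + J.act G.vec (poisson K F) = 0)

/-- `P` is a symplectic operator: the two-form `ω(X₁, X₂) = Re ∫ <X₁ u, P (X₂ u)> dx` is
skew-symmetric and closed, `X₁ ω(X₂, X₃) - ω([X₁, X₂], X₃) + cyclic = 0`. -/
def IsSymplectic (P : NonlocalOp.{v} n) : Prop :=
  ∀ J : JetAlgebra.{v} n,
    (∀ (X₁ X₂ : J.vf) (v₁ v₂ : J.Field), P J (J.comps X₁) v₁ → P J (J.comps X₂) v₂ →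
      J.integral (pairing (J.comps X₁) v₂) = -J.integral (pairing (J.comps X₂) v₁)) ∧
    (∀ (X₁ X₂ X₃ : J.vf) (v₁ v₂ v₃ : J.Field),
      P J (J.comps X₁) v₁ → P J (J.comps X₂) v₂ → P J (J.comps X₃) v₃ →
      (J.act X₁ (J.integral (pairing (J.comps X₂) v₃))
          - J.integral (pairing (J.comps ⁅X₁, X₂⁆) v₃))
        + (J.act X₂ (J.integral (pairing (J.comps X₃) v₁))
          - J.integral (pairing (J.comps ⁅X₂, X₃⁆) v₁))
        + (J.act X₃ (J.integral (pairing (J.comps X₁) v₂))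
          - J.integral (pairing (J.comps ⁅X₃, X₁⁆) v₂)) = 0)

/-- Compatibility of a cosymplectic operator `H` and a symplectic operator `S`: all linear
combinations `c₁ H + c₂ S⁻¹` are Hamiltonian cosymplectic operators, and all linear combinations
`c₁ H⁻¹ + c₂ S` are symplectic operators. -/
def Compatible (H S : NonlocalOp.{v} n) : Prop :=
  (∀ c₁ c₂ : ℝ, IsHamiltonian (comb c₁ c₂ H S.inverse)) ∧
  (∀ c₁ c₂ : ℝ, IsSymplectic (comb c₁ c₂ H.inverse S))

end NonlocalOp

/-- The operator `𝓗` on jet spaces. -/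
def opH (n : ℕ) : NonlocalOp.{v} n := fun J w v => hamRel J.D J.u w v

/-- The operator `𝓙` on jet spaces. -/
def opJ (n : ℕ) : NonlocalOp.{v} n := fun J h w => sympRel J.D J.u h w

/-! ## Smooth functions of `(t, x)` -/

/-- Smooth real functions on an open set of the `(t, x)`-plane. -/
def SmoothFn (U : TopologicalSpace.Opens (ℝ × ℝ)) : Subalgebra ℝ (U → ℝ) where
  carrier := {f | ContDiffOn ℝ ∞ (Function.extend Subtype.val f (0 : ℝ × ℝ → ℝ)) (U : Set (ℝ × ℝ))}
  mul_mem' := by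
    intro f g hf hg
    refine (ContDiffOn.mul hf hg).congr fun p hp => ?_
    have h : ∀ k : U → ℝ, Function.extend Subtype.val k (0 : ℝ × ℝ → ℝ) p = k ⟨p, hp⟩ := fun k =>
      Subtype.val_injective.extend_apply k 0 ⟨p, hp⟩
    simp [h]
  add_mem' := by
    intro f g hf hg
    refine (ContDiffOn.add hf hg).congr fun p hp => ?_
    have h : ∀ k : U → ℝ, Function.extend Subtype.val k (0 : ℝ × ℝ → ℝ) p = k ⟨p, hp⟩ := fun k =>
      Subtype.val_injective.extend_apply k 0 ⟨p, hp⟩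
    simp [h]
  algebraMap_mem' := by
    intro c
    refine (contDiffOn_const (c := c)).congr fun p hp => ?_
    have h : ∀ k : U → ℝ, Function.extend Subtype.val k (0 : ℝ × ℝ → ℝ) p = k ⟨p, hp⟩ := fun k =>
      Subtype.val_injective.extend_apply k 0 ⟨p, hp⟩
    simp [h]

namespace SmoothFn

variable {U : TopologicalSpace.Opens (ℝ × ℝ)}

/-- The extension by zero to the whole plane. -/
def ext (f : SmoothFn U) : ℝ × ℝ → ℝ := Function.extend Subtype.val f.1 0

theorem ext_apply (f : SmoothFn U) (p : U) : ext f p = f.1 p :=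
  Subtype.val_injective.extend_apply f.1 0 p

theorem differentiableAt_ext (f : SmoothFn U) (p : U) : DifferentiableAt ℝ (ext f) p := by
  have h : ContDiffOn ℝ ∞ (ext f) (U : Set (ℝ × ℝ)) := f.2
  exact (h.contDiffAt (U.isOpen.mem_nhds p.2)).differentiableAt (by simp)

theorem eventuallyEq_ext {f : SmoothFn U} {g : ℝ × ℝ → ℝ} (h : ∀ q : U, f.1 q = g q) (p : U) :
    ext f =ᶠ[nhds (p : ℝ × ℝ)] g := by
  filter_upwards [U.isOpen.mem_nhds p.2] with q hq
  rw [← h ⟨q, hq⟩]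
  exact ext_apply f ⟨q, hq⟩

/-- The derivative of a smooth function in the constant direction `e`. -/
def dir (e : ℝ × ℝ) (f : SmoothFn U) : SmoothFn U :=
  ⟨fun p => fderiv ℝ (ext f) p e, by
    have h : ContDiffOn ℝ ∞ (ext f) (U : Set (ℝ × ℝ)) := f.2
    have h' := ((contDiffOn_infty_iff_fderiv_of_isOpen U.isOpen).1 h).2
    have h'' : ContDiffOn ℝ ∞ (fun p => fderiv ℝ (ext f) p e) (U : Set (ℝ × ℝ)) :=
      h'.clm_apply contDiffOn_const
    refine h''.congr fun p hp => ?_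
    exact Subtype.val_injective.extend_apply (fun p : U => fderiv ℝ (ext f) p e)
      (0 : ℝ × ℝ → ℝ) (⟨p, hp⟩ : U)⟩

/-- The derivative in the constant direction `e`, as a derivation. -/
def deriv (e : ℝ × ℝ) : Derivation ℝ (SmoothFn U) (SmoothFn U) :=
  Derivation.mk'
    { toFun := dir e
      map_add' := by
        intro f g
        apply Subtype.ext
        funext p
        have h := (eventuallyEq_ext (f := f + g) (g := ext f + ext g)
          (fun q => by simp [ext_apply]) p).fderiv_eq (𝕜 := ℝ)
        change fderiv ℝ (ext (f + g)) p e = fderiv ℝ (ext f) p e + fderiv ℝ (ext g) p e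
        rw [h, fderiv_add (differentiableAt_ext f p) (differentiableAt_ext g p)]
        rfl
      map_smul' := by
        intro c f
        apply Subtype.ext
        funext p
        have h := (eventuallyEq_ext (f := c • f) (g := c • ext f)
          (fun q => by simp [ext_apply]) p).fderiv_eq (𝕜 := ℝ)
        change fderiv ℝ (ext (c • f)) p e = c • fderiv ℝ (ext f) p e
        rw [h, fderiv_const_smul (differentiableAt_ext f p)]
        rfl }
    (by
      intro f g
      apply Subtype.ext
      funext p
      have h := (eventuallyEq_ext (f := f * g) (g := ext f * ext g)
        (fun q => by simp [ext_apply]) p).fderiv_eq (𝕜 := ℝ)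
      change fderiv ℝ (ext (f * g)) p e
        = f.1 p * fderiv ℝ (ext g) p e + g.1 p * fderiv ℝ (ext f) p e
      rw [h, fderiv_mul (differentiableAt_ext f p) (differentiableAt_ext g p)]
      simp [ext_apply])

variable (U)

/-- The derivation `∂/∂t`. -/
def dt : Derivation ℝ (SmoothFn U) (SmoothFn U) := deriv (1, 0)

/-- The derivation `∂/∂x`. -/
def dx : Derivation ℝ (SmoothFn U) (SmoothFn U) := deriv (0, 1)

variable {U}

/-- The value at a point of a quaternion-valued smooth function. -/
def evalQ (p : U) (q : ℍ[SmoothFn U]) : ℍ[ℝ] := ⟨q.re.1 p, q.imI.1 p, q.imJ.1 p, q.imK.1 p⟩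

end SmoothFn

/-! ## Quaternionic projective space and parallel moving frames -/

section Geometry

/-- Index set of `(n + 1) × (n + 1)` matrices in blocks of sizes `1`, `1`, `n - 1`. -/
abbrev Idx (n : ℕ) : Type := Unit ⊕ (Unit ⊕ Fin (n - 1))

variable (n : ℕ)

/-- The quaternion unitary group `U(n + 1, ℍ) ≃ Sp(n + 1)`. -/
abbrev UH : Type := unitary (Matrix (Idx n) (Idx n) ℍ[ℝ])

/-- The isotropy group `U(1, ℍ) × U(n, ℍ)` of block diagonal elements of `U(n + 1, ℍ)`. -/
def isotropy : Subgroup (UH n) where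
  carrier := {g | ∀ j, g.1 (Sum.inl ()) (Sum.inr j) = 0 ∧ g.1 (Sum.inr j) (Sum.inl ()) = 0}
  one_mem' := by
    intro j
    simp
  mul_mem' := by
    intro a b ha hb j
    simp only [Set.mem_ofPred_eq] at ha hb
    constructor
    · simp [Matrix.mul_apply, Fintype.sum_sum_type, (ha _).1, (hb _).1]
    · simp [Matrix.mul_apply, Fintype.sum_sum_type, (ha _).2, (hb _).2]
  inv_mem' := by
    intro a ha j
    have h : (a⁻¹ : UH n).1 = star a.1 := rfl
    rw [h]
    constructor
    · simp [Matrix.star_apply, (ha j).2]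
    · simp [Matrix.star_apply, (ha j).1]

/-- Quaternionic projective space `ℍPⁿ = U(n + 1, ℍ) / (U(1, ℍ) × U(n, ℍ))`. -/
abbrev HP : Type := UH n ⧸ isotropy n

variable {n} {A : Type v} [CommRing A] [Algebra ℝ A]

/-- The element `(m, 𝐦)` of the space `𝔪` of the symmetric decomposition `𝔲(n+1, ℍ) = 𝔥 ⊕ 𝔪`. -/
def mMat (m : ℍ[A]) (mv : Fin (n - 1) → ℍ[A]) : Matrix (Idx n) (Idx n) ℍ[A]
  | Sum.inl _, Sum.inr (Sum.inl _) => m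
  | Sum.inl _, Sum.inr (Sum.inr j) => mv j
  | Sum.inr (Sum.inl _), Sum.inl _ => -star m
  | Sum.inr (Sum.inr i), Sum.inl _ => -star (mv i)
  | _, _ => 0

/-- The element `(h, 𝐡)` of `𝔥_⊥`: diagonal blocks `h`, `-h`, `0`, off-diagonal blocks `𝐡`, `-𝐡̄ᵗ`. -/
def hPerpMat (w : QField n A) : Matrix (Idx n) (Idx n) ℍ[A]
  | Sum.inl _, Sum.inl _ => w.1
  | Sum.inr (Sum.inl _), Sum.inr (Sum.inl _) => -w.1
  | Sum.inr (Sum.inl _), Sum.inr (Sum.inr j) => w.2 j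
  | Sum.inr (Sum.inr i), Sum.inr (Sum.inl _) => -star (w.2 i)
  | _, _ => 0

/-- The component in `𝔪_⊥` of a matrix in `𝔲(n + 1, ℍ)`, as a scalar-vector pair. -/
def mPerp (M : Matrix (Idx n) (Idx n) ℍ[A]) : QField n A :=
  (imPart (M (Sum.inl ()) (Sum.inr (Sum.inl ()))),
    fun j => M (Sum.inl ()) (Sum.inr (Sum.inr j)))

/-- The component in `𝔥_⊥` of a matrix in `𝔲(n + 1, ℍ)`, as a scalar-vector pair. -/
def hPerp (M : Matrix (Idx n) (Idx n) ℍ[A]) : QField n A :=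
  (imPart ((1 / 2 : ℝ) • (M (Sum.inl ()) (Sum.inl ())
      - M (Sum.inr (Sum.inl ())) (Sum.inr (Sum.inl ())))),
    fun j => M (Sum.inr (Sum.inl ())) (Sum.inr (Sum.inr j)))

/-- The normalization constant `χ = 8 (n + 2)` of the Cartan-Killing form on `𝔪`:
`⟨(m, 𝐦), (m, 𝐦)⟩ = -χ (|m|² + |𝐦|²)`. -/
def chi (n : ℕ) : ℝ := 8 * ((n : ℝ) + 2)

variable {U : TopologicalSpace.Opens (ℝ × ℝ)}

/-- A smooth moving frame along a map `γ` of the `(t, x)`-plane into `ℍPⁿ`: a smooth lift of `γ`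
to `U(n + 1, ℍ)`. The pullbacks of the `𝔪`-valued linear coframe `e` and of the `𝔥`-valued linear
connection `ω` by such a frame are the components of the left Maurer-Cartan form `g⁻¹ dg = e + ω`. -/
structure MovingFrame (γ : U → HP n) where
  /-- The matrix of smooth quaternion-valued functions. -/
  mat : Matrix (Idx n) (Idx n) ℍ[SmoothFn U]
  /-- Its values. -/
  lift : U → UH n
  lift_eq : ∀ p i j, (lift p).1 i j = SmoothFn.evalQ p (mat i j)
  proj : ∀ p, (QuotientGroup.mk (lift p) : HP n) = γ p

namespace MovingFrame

variable {γ : U → HP n} (g : MovingFrame γ)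

/-- `e_t + ω_t = g⁻¹ g_t`. -/
def formT : Matrix (Idx n) (Idx n) ℍ[SmoothFn U] :=
  g.mat.conjTranspose * dMat (SmoothFn.dt U) g.mat

/-- `e_x + ω_x = g⁻¹ g_x`. -/
def formX : Matrix (Idx n) (Idx n) ℍ[SmoothFn U] :=
  g.mat.conjTranspose * dMat (SmoothFn.dx U) g.mat

/-- The variable `(u, 𝐮)`: the component of `ω_x` in `𝔥_⊥`. -/
def u : QField n (SmoothFn U) := hPerp g.formX

/-- The frame is `U(1, ℍ) × U(n, ℍ)`-parallel: `e_x = χ^{-1/2} (1, 𝟎)` and `ω_x = (u, 𝐮) ∈ 𝔥_⊥`.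
In particular `-⟨e_x, e_x⟩ = |γ_x|² = 1`: the flow is non-stretching and `x` is the arclength. -/
def IsParallel : Prop :=
  g.formX = (Real.sqrt (chi n))⁻¹ • mMat (1 : ℍ[SmoothFn U]) 0 + hPerpMat g.u

/-- The variable `(w^⊥, 𝐰^⊥)`: the component of `ω_t` in `𝔥_⊥`. -/
def w : QField n (SmoothFn U) := hPerp g.formT

/-- The variable `(h^⊥, 𝐡^⊥) = √χ (2 h_⊥, -𝐡_⊥)`, where `(h_⊥, 𝐡_⊥)` is the component of `e_t` in
`𝔪_⊥`. This is `χ ad(e_x) (h_⊥, 𝐡_⊥)`. -/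
def h : QField n (SmoothFn U) :=
  (Real.sqrt (chi n) • (2 : ℝ) • (mPerp g.formT).1, -(Real.sqrt (chi n) • (mPerp g.formT).2))

/-- The flow of `(u, 𝐮)` has the operator form `u_t = 𝓗(w) + χ⁻¹ h`, `w = 𝓙(h)`. -/
def OperatorForm : Prop :=
  ∃ v : QField n (SmoothFn U),
    hamRel (SmoothFn.dx U) g.u g.w v ∧
    dField (SmoothFn.dt U) g.u = v + (chi n)⁻¹ • g.h ∧
    sympRel (SmoothFn.dx U) g.u g.h g.w

end MovingFrame

end Geometry

end

/-!
Let `∇ = D_x + ad (u, 𝐮)` on matrices, and let `e = (1, 𝟎) ∈ 𝔪`. The operators are `∇` read off on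
the two parts of the symmetric decomposition, with the integrals `D_x⁻¹` as components in the
centralizer of `e`: `v = 𝓗 w` means `∇ Ω = v` for some `Ω ∈ 𝔥` with `𝔥_⊥`-part `w`, and `w = 𝓙 h`
means `∇ μ = -[e, w]` for some `μ` in the off-diagonal block with `[e, μ] = h`. The flow equations
are therefore the `𝔥`- and `𝔪`-parts of the Maurer–Cartan equation of a parallel frame.

The pairings are `-1/2` times the trace form `∫ Re tr (M N) dx`, which is invariant and for which
`∇` and `ad e` are skew-adjoint derivations. In the pencil `∇ + λ ad e` the relation
`y = (c₁ 𝓗 + c₂ 𝓙⁻¹) w` is a condition on the coefficients of `(∇ + λ ad e) (Ω + λ μ)`; skewness of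
the form given by the inverse relation is skew-adjointness, and its closedness is the cyclic Leibniz
identity `⟨N x, [y, z]⟩ + ⟨N y, [z, x]⟩ + ⟨N z, [x, y]⟩ = 0` for a skew-adjoint derivation `N`. An
operator is Hamiltonian once its inverse is symplectic, with form `ω`, because
`{𝔉, 𝔊} = X_𝔊 𝔉 = ω(X_𝔊, X_𝔉)`.
-/

noncomputable section

attribute [local instance] LieRing.ofAssociativeRing

section InvariantForms

variable {R L F : Type*} [CommRing R] [LieRing L] [LieAlgebra R L] [AddCommGroup F] [Module R F]

/-- A symmetric invariant form on a Lie algebra, with values in a module: the analogue of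
`LinearMap.BilinForm.lieInvariant` needed for trace forms with values in functionals. -/
structure IsInvariantForm (B : L →ₗ[R] L →ₗ[R] F) : Prop where
  symm : ∀ x y, B x y = B y x
  apply_lie_left : ∀ x y z, B ⁅x, y⁆ z = B x ⁅y, z⁆

namespace IsInvariantForm

variable {B : L →ₗ[R] L →ₗ[R] F}

theorem apply_lie_rotate (hB : IsInvariantForm B) (x y z : L) : B x ⁅y, z⁆ = B y ⁅z, x⁆ := by
  rw [← hB.apply_lie_left, hB.symm, ← hB.apply_lie_left, hB.symm]

theorem isSkewAdjoint_ad (hB : IsInvariantForm B) (e : L) :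
    B.IsSkewAdjoint (LieDerivation.ad R L e) := by
  intro x y
  rw [Pi.neg_apply, LieDerivation.ad_apply_apply, LieDerivation.ad_apply_apply, ← lie_skew, map_neg,
    LinearMap.neg_apply, hB.apply_lie_left, map_neg]

theorem cyclic_sum_derivation (hB : IsInvariantForm B) {N : LieDerivation R L L}
    (hN : B.IsSkewAdjoint N) (x y z : L) :
    B (N x) ⁅y, z⁆ + B (N y) ⁅z, x⁆ + B (N z) ⁅x, y⁆ = 0 := by
  have leibniz : B (N x) ⁅y, z⁆ = -(B x ⁅y, N z⁆ + B x ⁅N y, z⁆) := by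
    rw [hN x ⁅y, z⁆, Pi.neg_apply, LieDerivation.apply_lie_eq_add, map_neg, map_add]
  rw [leibniz, hB.apply_lie_rotate x y (N z), hB.apply_lie_rotate y (N z) x,
    hB.apply_lie_rotate x (N y) z]
  abel

end IsInvariantForm

/-- `w` and `m` are potentials of `q` for the pencil of derivations `N + λ E`: the product
`(N + λ E) (w + λ m)` has no `λ`-term, and `q` is the combination of its other two coefficients with
weights `a` and `b`. -/
structure IsPotential (N E : LieDerivation R L L) (a b : R) (q w m : L) : Prop where
  eq_add : q = a • N w + b • E m
  apply_eq_neg : N m = -E w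

namespace IsPotential

variable {B : L →ₗ[R] L →ₗ[R] F} {N E : LieDerivation R L L} {a b : R}

theorem form_skew (hB : IsInvariantForm B) (hN : B.IsSkewAdjoint N) (hE : B.IsSkewAdjoint E)
    {q₁ w₁ m₁ q₂ w₂ m₂ : L} (h₁ : IsPotential N E a b q₁ w₁ m₁)
    (h₂ : IsPotential N E a b q₂ w₂ m₂) : B q₁ w₂ = -B q₂ w₁ := by
  have symmetricForm : ∀ {q w m q' w' m' : L}, IsPotential N E a b q w m →
      IsPotential N E a b q' w' m' → B q w' = a • B (N w) w' + b • B m (N m') := by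
    intro q w m q' w' m' h h'
    rw [h.eq_add, h'.apply_eq_neg, map_add, LinearMap.add_apply, map_smul, map_smul,
      LinearMap.smul_apply, LinearMap.smul_apply, hE m w', Pi.neg_apply]
  rw [symmetricForm h₁ h₂, symmetricForm h₂ h₁, hN w₁ w₂, Pi.neg_apply, map_neg, hB.symm w₁,
    hB.symm m₁, hN m₂ m₁, Pi.neg_apply, map_neg]
  module

/-- Moving `N` and `E` across the form turns the variation `X q` of `q` into `X w`; what is left
over comes from `[X, N] = ad q'`. -/
theorem form_variation (hB : IsInvariantForm B) (hN : B.IsSkewAdjoint N) (hE : B.IsSkewAdjoint E)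
    {X : L →ₗ[R] L} {q' : L} (hXN : ∀ x, X (N x) = N (X x) + ⁅q', x⁆)
    (hXE : ∀ x, X (E x) = E (X x)) {q₁ w₁ m₁ q₃ w₃ m₃ : L}
    (h₁ : IsPotential N E a b q₁ w₁ m₁) (h₃ : IsPotential N E a b q₃ w₃ m₃) :
    B (X q₁) w₃ + B q₃ (X w₁) = a • B q' ⁅w₁, w₃⁆ + b • B q' ⁅m₁, m₃⁆ := by
  have variation : N (X m₁) = -E (X w₁) - ⁅q', m₁⁆ := by
    rw [eq_sub_iff_add_eq, ← hXN, h₁.apply_eq_neg, map_neg, hXE]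
  have transport : B (E (X m₁)) w₃ = B (E (X w₁)) m₃ + B ⁅q', m₁⁆ m₃ := by
    have := hN (X m₁) m₃
    rw [variation, Pi.neg_apply, h₃.apply_eq_neg, neg_neg] at this
    rw [hE (X m₁) w₃, Pi.neg_apply, map_neg, ← this, map_sub, map_neg, LinearMap.sub_apply,
      LinearMap.neg_apply]
    abel
  have hX : X q₁ = a • (N (X w₁) + ⁅q', w₁⁆) + b • E (X m₁) := by
    rw [h₁.eq_add, map_add, map_smul, map_smul, hXN, hXE]
  rw [hB.symm q₃, hX, h₃.eq_add]
  simp only [map_add, map_smul, LinearMap.add_apply, LinearMap.smul_apply, transport,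
    hN (X w₁) w₃, hE (X w₁) m₃, Pi.neg_apply, map_neg, hB.apply_lie_left]
  module

/-- As `(N + λ E) (w + λ m) = N w + λ² E m`, the coefficients of `a²`, `ab`, `b²` are those of `1`,
`λ²`, `λ⁴` in the cyclic Leibniz identity for `N + λ E` and the elements `wᵢ + λ mᵢ`. -/
theorem cyclic_sum_form_lie (hB : IsInvariantForm B) (hN : B.IsSkewAdjoint N)
    (hE : B.IsSkewAdjoint E) {q₁ w₁ m₁ q₂ w₂ m₂ q₃ w₃ m₃ : L}
    (h₁ : IsPotential N E a b q₁ w₁ m₁) (h₂ : IsPotential N E a b q₂ w₂ m₂)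
    (h₃ : IsPotential N E a b q₃ w₃ m₃) :
    (a • B q₁ ⁅w₃, w₂⁆ + b • B q₁ ⁅m₃, m₂⁆) + (a • B q₂ ⁅w₁, w₃⁆ + b • B q₂ ⁅m₁, m₃⁆)
      + (a • B q₃ ⁅w₂, w₁⁆ + b • B q₃ ⁅m₂, m₁⁆) = 0 := by
  have mixed : ∀ (w m : L) {q' w' m' q'' w'' m'' : L},
      IsPotential N E a b q' w' m' → IsPotential N E a b q'' w'' m'' →
      B (N w) ⁅m', m''⁆ + B (E m) ⁅w', w''⁆ = B (E w') ⁅m'', w⁆ - B (E w') ⁅w'', m⁆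
        + (B (E w'') ⁅w, m'⁆ - B (E w'') ⁅m, w'⁆) := by
    intro w m q' w' m' q'' w'' m'' h' h''
    have hNw := hB.cyclic_sum_derivation hN w m' m''
    have hEm := hB.cyclic_sum_derivation hE m w' w''
    rw [h'.apply_eq_neg, h''.apply_eq_neg, map_neg, map_neg, LinearMap.neg_apply,
      LinearMap.neg_apply] at hNw
    linear_combination (norm := module) hNw + hEm
  have quadratic_N := hB.cyclic_sum_derivation hN w₁ w₃ w₂
  have quadratic_E := hB.cyclic_sum_derivation hE m₁ m₃ m₂
  have mixed₁ := mixed w₁ m₁ h₃ h₂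
  have mixed₂ := mixed w₂ m₂ h₁ h₃
  have mixed₃ := mixed w₃ m₃ h₂ h₁
  rw [h₁.eq_add, h₂.eq_add, h₃.eq_add]
  simp only [map_add, map_smul, LinearMap.add_apply, LinearMap.smul_apply]
  linear_combination (norm := module) (a * a) • quadratic_N + (b * b) • quadratic_E
    + (a * b) • mixed₁ + (a * b) • mixed₂ + (a * b) • mixed₃

theorem form_closed (hB : IsInvariantForm B) (hN : B.IsSkewAdjoint N) (hE : B.IsSkewAdjoint E)
    {q₁ w₁ m₁ q₂ w₂ m₂ q₃ w₃ m₃ : L}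
    (h₁ : IsPotential N E a b q₁ w₁ m₁) (h₂ : IsPotential N E a b q₂ w₂ m₂)
    (h₃ : IsPotential N E a b q₃ w₃ m₃) {X₁ X₂ X₃ : L →ₗ[R] L}
    (hXN₁ : ∀ x, X₁ (N x) = N (X₁ x) + ⁅q₁, x⁆) (hXN₂ : ∀ x, X₂ (N x) = N (X₂ x) + ⁅q₂, x⁆)
    (hXN₃ : ∀ x, X₃ (N x) = N (X₃ x) + ⁅q₃, x⁆) (hXE₁ : ∀ x, X₁ (E x) = E (X₁ x))
    (hXE₂ : ∀ x, X₂ (E x) = E (X₂ x)) (hXE₃ : ∀ x, X₃ (E x) = E (X₃ x)) :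
    (B (X₂ q₁) w₃ + B q₂ (X₁ w₃)) + (B (X₃ q₂) w₁ + B q₃ (X₂ w₁))
      + (B (X₁ q₃) w₂ + B q₁ (X₃ w₂)) = 0 := by
  have variation₁ := form_variation hB hN hE hXN₁ hXE₁ h₃ h₂
  have variation₂ := form_variation hB hN hE hXN₂ hXE₂ h₁ h₃
  have variation₃ := form_variation hB hN hE hXN₃ hXE₃ h₂ h₁
  linear_combination (norm := module)
    variation₁ + variation₂ + variation₃ + cyclic_sum_form_lie hB hN hE h₁ h₂ h₃

end IsPotential

end InvariantForms

section QuaternionicDerivations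

variable {A : Type v} [CommRing A] [Algebra ℝ A]

@[simp]
theorem dQ_re (D : Derivation ℝ A A) (a : ℍ[A]) : (dQ D a).re = D a.re := rfl

@[simp]
theorem dQ_imI (D : Derivation ℝ A A) (a : ℍ[A]) : (dQ D a).imI = D a.imI := rfl

@[simp]
theorem dQ_imJ (D : Derivation ℝ A A) (a : ℍ[A]) : (dQ D a).imJ = D a.imJ := rfl

@[simp]
theorem dQ_imK (D : Derivation ℝ A A) (a : ℍ[A]) : (dQ D a).imK = D a.imK := rfl

/-- `dQ D` as a real linear map. -/
@[simps]
def dQLin (D : Derivation ℝ A A) : ℍ[A] →ₗ[ℝ] ℍ[A] where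
  toFun := dQ D
  map_add' a b := by ext <;> simp
  map_smul' c a := by ext <;> simp

variable (D : Derivation ℝ A A)

theorem dQ_add (a b : ℍ[A]) : dQ D (a + b) = dQ D a + dQ D b := map_add (dQLin D) a b

theorem dQ_sub (a b : ℍ[A]) : dQ D (a - b) = dQ D a - dQ D b := map_sub (dQLin D) a b

theorem dQ_neg (a : ℍ[A]) : dQ D (-a) = -dQ D a := map_neg (dQLin D) a

theorem dQ_smul (c : ℝ) (a : ℍ[A]) : dQ D (c • a) = c • dQ D a := map_smul (dQLin D) c a

@[simp]
theorem dQ_zero : dQ D 0 = 0 := map_zero (dQLin D)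

theorem dQ_coe (r : A) : dQ D (r : ℍ[A]) = ((D r : A) : ℍ[A]) := by
  ext <;> simp

theorem dQ_mul (a b : ℍ[A]) : dQ D (a * b) = dQ D a * b + a * dQ D b := by
  ext <;> simp <;> ring

theorem dQ_star (a : ℍ[A]) : dQ D (star a) = star (dQ D a) := by
  ext <;> simp

variable {ι : Type*}

@[simp]
theorem dMat_apply (M : Matrix ι ι ℍ[A]) (i j : ι) : dMat D M i j = dQ D (M i j) := rfl

theorem dMat_smul (c : ℝ) (M : Matrix ι ι ℍ[A]) : dMat D (c • M) = c • dMat D M :=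
  map_smul (dQLin D).mapMatrix c M

theorem dMat_sub (M N : Matrix ι ι ℍ[A]) : dMat D (M - N) = dMat D M - dMat D N :=
  map_sub (dQLin D).mapMatrix M N

theorem dMat_add (M N : Matrix ι ι ℍ[A]) : dMat D (M + N) = dMat D M + dMat D N :=
  map_add (dQLin D).mapMatrix M N

theorem dMat_conjTranspose (M : Matrix ι ι ℍ[A]) :
    dMat D M.conjTranspose = (dMat D M).conjTranspose := by
  ext1 i j
  exact dQ_star D _

theorem dMat_comm {D E : Derivation ℝ A A} (h : ∀ a, D (E a) = E (D a)) (M : Matrix ι ι ℍ[A]) :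
    dMat D (dMat E M) = dMat E (dMat D M) := by
  ext1 i j
  ext <;> simp [h]

theorem dMat_commutator (X Y : Derivation ℝ A A) (M : Matrix ι ι ℍ[A]) :
    dMat ⁅X, Y⁆ M = dMat X (dMat Y M) - dMat Y (dMat X M) := by
  ext1 i j
  ext <;> simp [Derivation.commutator_apply]

variable [Fintype ι]

theorem dMat_mul (M N : Matrix ι ι ℍ[A]) : dMat D (M * N) = dMat D M * N + M * dMat D N := by
  ext1 i j
  change dQLin D _ = _
  simp only [Matrix.add_apply, Matrix.mul_apply, map_sum, dQLin_apply, dQ_mul,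
    Finset.sum_add_distrib, dMat_apply]

variable [DecidableEq ι]

/-- `dMat D` as a derivation of the Lie algebra of quaternionic matrices. -/
def dMatDer : LieDerivation ℝ (Matrix ι ι ℍ[A]) (Matrix ι ι ℍ[A]) where
  __ := (dQLin D).mapMatrix
  leibniz' M N := by
    change dMat D ⁅M, N⁆ = ⁅M, dMat D N⁆ - ⁅N, dMat D M⁆
    rw [Ring.lie_def, Ring.lie_def, Ring.lie_def, dMat_sub, dMat_mul, dMat_mul]
    abel

@[simp]
theorem dMatDer_apply (M : Matrix ι ι ℍ[A]) : dMatDer D M = dMat D M := rfl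

end QuaternionicDerivations

section RealTrace

variable {A : Type v} [CommRing A] [Algebra ℝ A] {ι : Type*} [Fintype ι]

/-- The real part of the trace of a quaternionic matrix, which unlike the trace itself does not
depend on the order of a product. -/
def reTrace : Matrix ι ι ℍ[A] →ₗ[ℝ] A :=
  (QuaternionAlgebra.reₗ (R := A) _ _ _).restrictScalars ℝ ∘ₗ Matrix.traceLinearMap ι ℝ ℍ[A]

theorem reTrace_eq_sum (M : Matrix ι ι ℍ[A]) : reTrace M = ∑ i, (M i i).re :=
  map_sum (QuaternionAlgebra.reₗ (R := A) _ _ _) _ _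

theorem reTrace_mul_comm (M N : Matrix ι ι ℍ[A]) : reTrace (M * N) = reTrace (N * M) := by
  have re_mul_comm (a b : ℍ[A]) : (a * b).re = (b * a).re := by
    simp only [Quaternion.re_mul]
    ring
  have reTrace_mul (M N : Matrix ι ι ℍ[A]) : reTrace (M * N) = ∑ i, ∑ j, (M i j * N j i).re := by
    rw [reTrace_eq_sum]
    exact Finset.sum_congr rfl fun i _ => map_sum (QuaternionAlgebra.reₗ (R := A) _ _ _) _ _
  rw [reTrace_mul, reTrace_mul, Finset.sum_comm]
  simp only [re_mul_comm]

theorem reTrace_dMat (D : Derivation ℝ A A) (M : Matrix ι ι ℍ[A]) :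
    reTrace (dMat D M) = D (reTrace M) := by
  simp only [reTrace_eq_sum, map_sum]
  rfl

end RealTrace

section Blocks

variable {n : ℕ} {A : Type v} [CommRing A]

theorem star_herm (a b : Fin (n - 1) → ℍ[A]) : star (herm a b) = herm b a := by
  simp [herm]

/-- The matrix in `𝔥 = 𝔥_⊥ ⊕ 𝔥_∥` whose component in `𝔥_⊥` is `(w, 𝐰)` and whose component in the
centralizer `𝔥_∥` of `(1, 𝟎) ∈ 𝔪` has diagonal blocks `p`, `p`, `V`. The entries `w`, `p`, `V` are
not required to be skew-Hermitian. -/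
def hMat (w : ℍ[A]) (wv : Fin (n - 1) → ℍ[A]) (p : ℍ[A])
    (V : Matrix (Fin (n - 1)) (Fin (n - 1)) ℍ[A]) : Matrix (Idx n) (Idx n) ℍ[A]
  | Sum.inl _, Sum.inl _ => w + p
  | Sum.inr (Sum.inl _), Sum.inr (Sum.inl _) => -w + p
  | Sum.inr (Sum.inl _), Sum.inr (Sum.inr j) => wv j
  | Sum.inr (Sum.inr i), Sum.inr (Sum.inl _) => -star (wv i)
  | Sum.inr (Sum.inr i), Sum.inr (Sum.inr j) => V i j
  | _, _ => 0

variable (n A) in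
/-- The element `(1, 𝟎)` of `𝔪`, the direction of the tangent vector of the curve. -/
abbrev mOne : Matrix (Idx n) (Idx n) ℍ[A] := mMat 1 0

theorem mMat_inj {m m' : ℍ[A]} {mv mv' : Fin (n - 1) → ℍ[A]} :
    mMat m mv = mMat m' mv' ↔ m = m' ∧ mv = mv' := by
  refine ⟨fun h => ⟨?_, ?_⟩, by rintro ⟨rfl, rfl⟩; rfl⟩
  · exact congr_fun₂ h (Sum.inl ()) (Sum.inr (Sum.inl ()))
  · exact funext fun j => congr_fun₂ h (Sum.inl ()) (Sum.inr (Sum.inr j))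

theorem hMat_add_hMat (w w' p p' : ℍ[A]) (wv wv' : Fin (n - 1) → ℍ[A])
    (V V' : Matrix (Fin (n - 1)) (Fin (n - 1)) ℍ[A]) :
    hMat w wv p V + hMat w' wv' p' V' = hMat (w + w') (wv + wv') (p + p') (V + V') := by
  ext1 (_ | _ | i) (_ | _ | j) <;> simp [hMat] <;> abel

theorem mMat_add_mMat (m m' : ℍ[A]) (mv mv' : Fin (n - 1) → ℍ[A]) :
    mMat m mv + mMat m' mv' = mMat (m + m') (mv + mv') := by
  ext1 (_ | _ | i) (_ | _ | j) <;> simp [mMat] <;> abel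

theorem lie_mOne_mMat (m : ℍ[A]) (mv : Fin (n - 1) → ℍ[A]) :
    ⁅mOne n A, mMat m mv⁆ = hMat (m - star m) (-mv) 0 0 := by
  rw [Ring.lie_def]
  ext1 (_ | _ | i) (_ | _ | j) <;>
    simp [Matrix.mul_apply, Fintype.sum_sum_type, hMat, mMat] <;>
    abel

theorem star_opA (u v : ℍ[A]) : star (opA u v) = opA (star u) (star v) := by
  rw [opA, opA, star_add, star_mul, star_mul, add_comm]

variable [Algebra ℝ A]

theorem star_imH (a : imH A) : star (a : ℍ[A]) = -(a : ℍ[A]) := by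
  have h : (a : ℍ[A]).re = 0 := a.2
  ext <;> simp [h]

theorem hPerpMat_eq_hMat (w : QField n A) : hPerpMat w = hMat (w.1 : ℍ[A]) w.2 0 0 := by
  ext1 (_ | _ | i) (_ | _ | j) <;> simp [hPerpMat, hMat]

theorem hMat_inj {w w' p p' : ℍ[A]} {wv wv' : Fin (n - 1) → ℍ[A]}
    {V V' : Matrix (Fin (n - 1)) (Fin (n - 1)) ℍ[A]} :
    hMat w wv p V = hMat w' wv' p' V' ↔ w = w' ∧ wv = wv' ∧ p = p' ∧ V = V' := by
  refine ⟨fun h => ?_, by rintro ⟨rfl, rfl, rfl, rfl⟩; rfl⟩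
  have sum : w + p = w' + p' := congr_fun₂ h (Sum.inl ()) (Sum.inl ())
  have diff : -w + p = -w' + p' := congr_fun₂ h (Sum.inr (Sum.inl ())) (Sum.inr (Sum.inl ()))
  refine ⟨?_, ?_, ?_, ?_⟩
  · linear_combination (norm := module) (1 / 2 : ℝ) • sum - (1 / 2 : ℝ) • diff
  · exact funext fun j => congr_fun₂ h (Sum.inr (Sum.inl ())) (Sum.inr (Sum.inr j))
  · linear_combination (norm := module) (1 / 2 : ℝ) • sum + (1 / 2 : ℝ) • diff
  · exact Matrix.ext fun i j => congr_fun₂ h (Sum.inr (Sum.inr i)) (Sum.inr (Sum.inr j))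

theorem hMat_eq_hPerpMat_iff {w p : ℍ[A]} {wv : Fin (n - 1) → ℍ[A]}
    {V : Matrix (Fin (n - 1)) (Fin (n - 1)) ℍ[A]} {v : QField n A} :
    hMat w wv p V = hPerpMat v ↔ w = v.1 ∧ wv = v.2 ∧ p = 0 ∧ V = 0 := by
  rw [hPerpMat_eq_hMat, hMat_inj]

variable (D : Derivation ℝ A A)

theorem dMat_hMat (w : ℍ[A]) (wv : Fin (n - 1) → ℍ[A]) (p : ℍ[A])
    (V : Matrix (Fin (n - 1)) (Fin (n - 1)) ℍ[A]) :
    dMat D (hMat w wv p V) = hMat (dQ D w) (fun i => dQ D (wv i)) (dQ D p) (dMat D V) := by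
  ext1 (_ | _ | i) (_ | _ | j) <;> simp [hMat, dQ_add, dQ_neg, dQ_star]

theorem dMat_mMat (m : ℍ[A]) (mv : Fin (n - 1) → ℍ[A]) :
    dMat D (mMat m mv) = mMat (dQ D m) (fun i => dQ D (mv i)) := by
  ext1 (_ | _ | i) (_ | _ | j) <;> simp [mMat, dQ_neg, dQ_star]

theorem lie_hPerpMat_hMat (u w : QField n A) (p : imH A)
    {V : Matrix (Fin (n - 1)) (Fin (n - 1)) ℍ[A]} (hV : V.conjTranspose = -V) :
    ⁅hPerpMat u, hMat (w.1 : ℍ[A]) w.2 p V⁆ =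
      hMat (opC u.1 p + opCv u.2 w.2)
        (opR u.2 w.1 - opL u.1 w.2 + opLm u.2 V - opR u.2 p)
        (opC u.1 w.1 - opCv u.2 w.2) (-opCm u.2 w.2) := by
  have star_V (i j) : star (V i j) = -V j i := congr_fun₂ hV j i
  rw [Ring.lie_def]
  ext1 (_ | _ | i) (_ | _ | j) <;>
    simp [Matrix.mul_apply, Fintype.sum_sum_type, hPerpMat, hMat, opC, opCv, opR, opL, opLm, opCm,
      herm, star_imH, Matrix.vecMul, dotProduct, star_V, mul_add, add_mul] <;>
    module

theorem lie_hPerpMat_mMat (u : QField n A) (m : ℍ[A]) (mv : Fin (n - 1) → ℍ[A]) :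
    ⁅hPerpMat u, mMat m mv⁆ = mMat (opA u.1 m + herm mv u.2) (opL u.1 mv - opR u.2 m) := by
  rw [Ring.lie_def]
  ext1 (_ | _ | i) (_ | _ | j) <;>
    simp [Matrix.mul_apply, Fintype.sum_sum_type, hPerpMat, mMat, opA, opR, opL, herm, star_imH] <;>
    abel

theorem lie_hMat_mOne (w p : imH A) (wv : Fin (n - 1) → ℍ[A])
    (V : Matrix (Fin (n - 1)) (Fin (n - 1)) ℍ[A]) :
    ⁅hMat (w : ℍ[A]) wv p V, mOne n A⁆ = mMat ((2 : ℝ) • (w : ℍ[A])) (-wv) := by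
  rw [Ring.lie_def]
  ext1 (_ | _ | i) (_ | _ | j) <;>
    simp [Matrix.mul_apply, Fintype.sum_sum_type, hMat, mMat, star_imH, two_smul]

theorem lie_hPerpMat_mOne (w : QField n A) :
    ⁅hPerpMat w, mOne n A⁆ = mMat ((2 : ℝ) • (w.1 : ℍ[A])) (-w.2) := by
  rw [hPerpMat_eq_hMat]
  exact lie_hMat_mOne w.1 0 w.2 0

/-- The covariant derivative `D_x + ad (u, 𝐮)`. -/
def covDer (u : QField n A) :
    LieDerivation ℝ (Matrix (Idx n) (Idx n) ℍ[A]) (Matrix (Idx n) (Idx n) ℍ[A]) :=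
  dMatDer D + LieDerivation.ad ℝ _ (hPerpMat u)

theorem covDer_apply (u : QField n A) (M : Matrix (Idx n) (Idx n) ℍ[A]) :
    covDer D u M = dMat D M + ⁅hPerpMat u, M⁆ := by
  simp [covDer]

theorem dMat_covDer {X : Derivation ℝ A A} (hX : ∀ a, X (D a) = D (X a)) (u : QField n A)
    (M : Matrix (Idx n) (Idx n) ℍ[A]) :
    dMat X (covDer D u M) = covDer D u (dMat X M) + ⁅dMat X (hPerpMat u), M⁆ := by
  simp only [covDer_apply, Ring.lie_def, dMat_add, dMat_sub, dMat_mul, dMat_comm hX]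
  abel

theorem hamRel_iff (u w v : QField n A) :
    hamRel D u w v ↔ ∃ (p : imH A) (V : Matrix (Fin (n - 1)) (Fin (n - 1)) ℍ[A]),
      V.conjTranspose = -V ∧ covDer D u (hMat (w.1 : ℍ[A]) w.2 p V) = hPerpMat v := by
  have opC_neg (p : ℍ[A]) : opC (u.1 : ℍ[A]) (-p) = -opC u.1 p := by simp [opC, neg_add_eq_sub]
  have opR_neg (p : ℍ[A]) : opR u.2 (-p) = -opR u.2 p := by ext1 i; simp [opR]
  refine (Equiv.neg (imH A)).exists_congr fun p => exists_congr fun V =>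
    and_congr_right fun hV => ?_
  rw [covDer_apply, lie_hPerpMat_hMat u w _ hV, dMat_hMat, hMat_add_hMat, hMat_eq_hPerpMat_iff]
  simp only [Equiv.neg_apply, Submodule.coe_neg, dQ_neg, opC_neg, opR_neg]
  constructor
  · rintro ⟨hp, hV', hv₁, hv₂⟩
    rw [hp, hV', hv₁, hv₂]
    refine ⟨?_, ?_, ?_, ?_⟩ <;> abel
  · rintro ⟨hv₁, hv₂, hp, hV'⟩
    rw [← hv₁, ← hv₂]
    refine ⟨?_, ?_, by abel, by abel⟩
    · linear_combination (norm := module) (-1 : ℝ) • hp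
    · linear_combination (norm := module) hV'

theorem star_opCv (a b : Fin (n - 1) → ℍ[A]) : star (opCv a b) = -opCv a b := by
  rw [opCv, Quaternion.star_smul, star_sub, star_herm, star_herm, ← smul_neg, neg_sub]

theorem star_opAv (a b : Fin (n - 1) → ℍ[A]) : star (opAv a b) = opAv a b := by
  rw [opAv, Quaternion.star_smul, star_add, star_herm, star_herm, add_comm]

theorem add_eq_iff_of_star {a b c : ℍ[A]} (ha : star a = -a) (hb : star b = b)
    (hc : star c = -c) : a + b = c ↔ a = c ∧ b = 0 := by
  refine ⟨fun h => ?_, fun ⟨h₁, h₂⟩ => by rw [h₁, h₂, add_zero]⟩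
  have h' : -a + b = -c := by rw [← ha, ← hc, ← h, star_add, hb]
  constructor
  · linear_combination (norm := module) (1 / 2 : ℝ) • h - (1 / 2 : ℝ) • h'
  · linear_combination (norm := module) (1 / 2 : ℝ) • h + (1 / 2 : ℝ) • h'

theorem lie_mOne_mMat_eq_hPerpMat_iff {m : ℍ[A]} {mv : Fin (n - 1) → ℍ[A]} {h : QField n A} :
    ⁅mOne n A, mMat m mv⁆ = hPerpMat h ↔
      (∃ r : A, m = (1 / 2 : ℝ) • (h.1 : ℍ[A]) - r) ∧ mv = -h.2 := by
  rw [lie_mOne_mMat, hMat_eq_hPerpMat_iff, neg_eq_iff_eq_neg]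
  simp only [and_true]
  refine and_congr_left fun _ => ⟨fun hm => ⟨-m.re, ?_⟩, ?_⟩
  · ext <;> simp [← hm] <;> module
  · rintro ⟨r, rfl⟩
    rw [star_sub, Quaternion.star_smul, star_imH, Quaternion.star_coe]
    module

theorem covDer_mMat (u h : QField n A) (r : A) :
    covDer D u (mMat ((1 / 2 : ℝ) • (h.1 : ℍ[A]) - r) (-h.2)) =
      mMat (((1 / 2 : ℝ) • dQ D h.1 + opCv u.2 h.2 - opA u.1 (r : ℍ[A]))
          + ((1 / 2 : ℝ) • opA u.1 h.1 - opAv u.2 h.2 - ((D r : A) : ℍ[A])))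
        (-((1 / 2 : ℝ) • opR u.2 h.1 + (fun i => dQ D (h.2 i)) + opL u.1 h.2
          - opR u.2 (r : ℍ[A]))) := by
  rw [covDer_apply, lie_hPerpMat_mMat, dMat_mMat, mMat_add_mMat, mMat_inj]
  constructor
  · rw [dQ_sub, dQ_smul, dQ_coe, opAv, opCv]
    simp only [opA, herm, mul_sub, sub_mul, mul_smul_comm, smul_mul_assoc, Pi.neg_apply, neg_mul,
      Finset.sum_neg_distrib]
    module
  · ext1 i
    simp only [opR, opL, dQ_neg, sub_mul, smul_mul_assoc, Pi.add_apply, Pi.sub_apply, Pi.neg_apply,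
      Pi.smul_apply, mul_neg]
    module

theorem covDer_mMat_eq_iff (u h w : QField n A) (r : A) :
    covDer D u (mMat ((1 / 2 : ℝ) • (h.1 : ℍ[A]) - r) (-h.2)) = -⁅mOne n A, hPerpMat w⁆ ↔
      ((D r : A) : ℍ[A]) = (1 / 2 : ℝ) • opA u.1 h.1 - opAv u.2 h.2 ∧
      (w.1 : ℍ[A]) = (1 / 4 : ℝ) • dQ D h.1 + (1 / 2 : ℝ) • opCv u.2 h.2
        - (1 / 2 : ℝ) • opA u.1 (r : ℍ[A]) ∧
      w.2 = (1 / 2 : ℝ) • opR u.2 h.1 + (fun i => dQ D (h.2 i)) + opL u.1 h.2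
        - opR u.2 (r : ℍ[A]) := by
  have neg_opA (a b : ℍ[A]) : opA (-a) b = -opA a b := by simp [opA, add_comm]
  have opA_neg (a b : ℍ[A]) : opA a (-b) = -opA a b := by simp [opA, add_comm]
  have imaginary : star ((1 / 2 : ℝ) • dQ D h.1 + opCv u.2 h.2 - opA u.1 (r : ℍ[A])) =
      -((1 / 2 : ℝ) • dQ D h.1 + opCv u.2 h.2 - opA u.1 (r : ℍ[A])) := by
    simp only [star_add, star_sub, Quaternion.star_smul, ← dQ_star, star_opCv, star_opA, star_imH,
      Quaternion.star_coe, dQ_neg, neg_opA]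
    module
  have real : star ((1 / 2 : ℝ) • opA u.1 h.1 - opAv u.2 h.2 - ((D r : A) : ℍ[A])) =
      (1 / 2 : ℝ) • opA u.1 h.1 - opAv u.2 h.2 - ((D r : A) : ℍ[A]) := by
    simp only [star_sub, Quaternion.star_smul, star_opAv, star_opA, star_imH, Quaternion.star_coe,
      neg_opA, opA_neg, neg_neg]
  have imaginary_w : star ((2 : ℝ) • (w.1 : ℍ[A])) = -((2 : ℝ) • (w.1 : ℍ[A])) := by
    rw [Quaternion.star_smul, star_imH, smul_neg]
  rw [covDer_mMat, lie_skew, lie_hPerpMat_mOne, mMat_inj,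
    add_eq_iff_of_star imaginary real imaginary_w, neg_inj, sub_eq_zero, eq_comm (b := w.2)]
  constructor
  · rintro ⟨⟨hw, hr⟩, hv⟩
    exact ⟨hr.symm, by linear_combination (norm := module) (-1 / 2 : ℝ) • hw, hv⟩
  · rintro ⟨hr, hw, hv⟩
    exact ⟨⟨by linear_combination (norm := module) (-2 : ℝ) • hw, hr.symm⟩, hv⟩

theorem sympRel_iff (u h w : QField n A) :
    sympRel D u h w ↔ ∃ (m : ℍ[A]) (mv : Fin (n - 1) → ℍ[A]),
      ⁅mOne n A, mMat m mv⁆ = hPerpMat h ∧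
        covDer D u (mMat m mv) = -⁅mOne n A, hPerpMat w⁆ := by
  simp only [lie_mOne_mMat_eq_hPerpMat_iff, sympRel, ← covDer_mMat_eq_iff]
  constructor
  · rintro ⟨r, hr⟩
    exact ⟨_, _, ⟨⟨r, rfl⟩, rfl⟩, hr⟩
  · rintro ⟨_, _, ⟨⟨r, rfl⟩, rfl⟩, hr⟩
    exact ⟨r, hr⟩

theorem hMat_add_mMat_eq_hPerpMat_iff {w p m : ℍ[A]} {wv mv : Fin (n - 1) → ℍ[A]}
    {V : Matrix (Fin (n - 1)) (Fin (n - 1)) ℍ[A]} {v : QField n A} :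
    hMat w wv p V + mMat m mv = hPerpMat v ↔ hMat w wv p V = hPerpMat v ∧ mMat m mv = 0 := by
  refine ⟨fun h => ?_, fun ⟨h₁, h₂⟩ => by rw [h₁, h₂, add_zero]⟩
  have h₁ : 0 + m = 0 := congr_fun₂ h (Sum.inl ()) (Sum.inr (Sum.inl ()))
  have h₂ (j) : 0 + mv j = 0 := congr_fun₂ h (Sum.inl ()) (Sum.inr (Sum.inr j))
  have hm : mMat m mv = 0 := by
    ext1 (_ | _ | i) (_ | _ | j) <;> simp_all [mMat]
  rw [hm, add_zero] at h
  exact ⟨h, hm⟩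

theorem coe_imPart (q : ℍ[A]) : (imPart q : ℍ[A]) = (1 / 2 : ℝ) • (q - star q) := by
  have half_add_self (a : A) : a = (1 / 2 : ℝ) • (a + a) := by module
  ext
  · simp [imPart]
  · simpa [imPart] using half_add_self q.imI
  · simpa [imPart] using half_add_self q.imJ
  · simpa [imPart] using half_add_self q.imK

theorem coe_imPart_of_star {q : ℍ[A]} (h : star q = -q) : (imPart q : ℍ[A]) = q := by
  rw [coe_imPart, h]
  module

theorem exists_eq_hMat_add_mMat {M : Matrix (Idx n) (Idx n) ℍ[A]} (hM : M.conjTranspose = -M) :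
    ∃ (p : imH A) (V : Matrix (Fin (n - 1)) (Fin (n - 1)) ℍ[A]), V.conjTranspose = -V ∧
      M = hMat ((hPerp M).1 : ℍ[A]) (hPerp M).2 p V +
        mMat (M (Sum.inl ()) (Sum.inr (Sum.inl ())))
          (fun j => M (Sum.inl ()) (Sum.inr (Sum.inr j))) := by
  have star_apply (i j) : star (M i j) = -M j i := congr_fun₂ hM j i
  have coe_half (i j) (c : ℝ) : (imPart ((1 / 2 : ℝ) • (M i i + c • M j j)) : ℍ[A]) =
      (1 / 2 : ℝ) • (M i i + c • M j j) := by
    apply coe_imPart_of_star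
    simp only [Quaternion.star_smul, star_add, star_apply]
    module
  refine ⟨imPart ((1 / 2 : ℝ) • (M (Sum.inl ()) (Sum.inl ())
      + (1 : ℝ) • M (Sum.inr (Sum.inl ())) (Sum.inr (Sum.inl ())))),
    fun i j => M (Sum.inr (Sum.inr i)) (Sum.inr (Sum.inr j)),
    Matrix.ext fun i j => star_apply _ _, ?_⟩
  have hPerp_fst : ((hPerp M).1 : ℍ[A]) = (1 / 2 : ℝ) • (M (Sum.inl ()) (Sum.inl ())
      + (-1 : ℝ) • M (Sum.inr (Sum.inl ())) (Sum.inr (Sum.inl ()))) := by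
    rw [← coe_half, neg_one_smul, ← sub_eq_add_neg, hPerp]
  rw [coe_half, hPerp_fst]
  ext1 (_ | _ | i) (_ | _ | j) <;>
    simp only [hMat, mMat, hPerp, star_apply, Matrix.add_apply, neg_neg, add_zero, zero_add] <;>
    module

theorem reTrace_hPerpMat_mul_hMat (z w : QField n A) (p : imH A)
    (V : Matrix (Fin (n - 1)) (Fin (n - 1)) ℍ[A]) :
    reTrace (hPerpMat z * hMat (w.1 : ℍ[A]) w.2 p V) = (-2 : ℝ) • pairing z w := by
  have re_star_mul (a b : ℍ[A]) : (star a * b).re = (a * star b).re := by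
    simp only [Quaternion.re_mul, Quaternion.re_star, Quaternion.imI_star, Quaternion.imJ_star,
      Quaternion.imK_star]
    ring
  have re_sum {m : ℕ} (a : Fin m → ℍ[A]) : (∑ i, a i).re = ∑ i, (a i).re :=
    map_sum (QuaternionAlgebra.reₗ (R := A) _ _ _) _ _
  rw [reTrace_eq_sum, pairing, star_imH]
  simp only [Matrix.mul_apply, Fintype.sum_sum_type, Finset.univ_unique, Finset.sum_singleton,
    hPerpMat, hMat, herm, zero_mul, mul_zero, Finset.sum_const_zero, add_zero, zero_add,
    Quaternion.re_zero, Quaternion.re_add, re_sum, neg_mul, mul_neg, Quaternion.re_neg,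
    re_star_mul, mul_add, neg_neg, Finset.sum_neg_distrib]
  module

theorem hPerpMat_add (w w' : QField n A) : hPerpMat (w + w') = hPerpMat w + hPerpMat w' := by
  ext1 (_ | _ | i) (_ | _ | j) <;> simp [hPerpMat, add_comm]

theorem hPerpMat_sub (w w' : QField n A) : hPerpMat (w - w') = hPerpMat w - hPerpMat w' := by
  ext1 (_ | _ | i) (_ | _ | j) <;> simp [hPerpMat, add_comm, sub_eq_add_neg]

theorem hPerpMat_smul (c : ℝ) (w : QField n A) : hPerpMat (c • w) = c • hPerpMat w := by
  ext1 (_ | _ | i) (_ | _ | j) <;> simp [hPerpMat, Quaternion.star_smul]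

theorem dMat_hPerpMat (w : QField n A) : dMat D (hPerpMat w) = hPerpMat (dField D w) := by
  ext1 (_ | _ | i) (_ | _ | j) <;> simp [hPerpMat, dField, dIm, dQ_neg, dQ_star]

theorem dMat_mOne : dMat D (mOne n A) = 0 := by
  have dQ_one : dQ D 1 = 0 := by ext <;> simp
  ext1 (_ | _ | i) (_ | _ | j) <;> simp [mMat, dQ_neg, dQ_one]

end Blocks

section JetSpaces

variable {n : ℕ}

theorem pairing_comm {A : Type v} [CommRing A] [Algebra ℝ A] (a b : QField n A) :
    pairing a b = pairing b a := by
  rw [pairing, pairing, ← Quaternion.re_star, star_add, star_mul, star_star, star_herm]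

namespace JetAlgebra

variable (J : JetAlgebra.{v} n)

/-- The invariant form `∫ Re tr (M N) dx` on matrices over the jet space, a functional. -/
def traceForm : Matrix (Idx n) (Idx n) ℍ[J.carrier] →ₗ[ℝ]
    Matrix (Idx n) (Idx n) ℍ[J.carrier] →ₗ[ℝ] J.Functional :=
  (LinearMap.mul ℝ _).compr₂ (Submodule.mkQ _ ∘ₗ reTrace)

theorem traceForm_apply (M N : Matrix (Idx n) (Idx n) ℍ[J.carrier]) :
    J.traceForm M N = J.integral (reTrace (M * N)) := rfl

theorem isInvariantForm_traceForm : IsInvariantForm J.traceForm where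
  symm M N := by rw [traceForm_apply, traceForm_apply, reTrace_mul_comm]
  apply_lie_left M N K := by
    have rotate : reTrace (N * M * K) = reTrace (M * (K * N)) := by
      rw [mul_assoc, reTrace_mul_comm, mul_assoc]
    rw [traceForm_apply, traceForm_apply, Ring.lie_def, Ring.lie_def, sub_mul, mul_sub, map_sub,
      map_sub, rotate, mul_assoc]

theorem act_traceForm (X : J.vf) (M N : Matrix (Idx n) (Idx n) ℍ[J.carrier]) :
    J.act X (J.traceForm M N) = J.traceForm (dMat X.1 M) N + J.traceForm M (dMat X.1 N) := by
  change J.integral (X.1 (reTrace (M * N))) = _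
  rw [← reTrace_dMat, dMat_mul, map_add]
  rfl

theorem isSkewAdjoint_covDer (w : J.Field) : J.traceForm.IsSkewAdjoint (covDer J.D w) := by
  intro M N
  have integration_by_parts : J.traceForm (dMat J.D M) N = -J.traceForm M (dMat J.D N) := by
    rw [eq_neg_iff_add_eq_zero]
    simp only [traceForm_apply]
    refine (Submodule.Quotient.mk_eq_zero _).2 ⟨reTrace (M * N), ?_⟩
    change J.D (reTrace (M * N)) = reTrace (dMat J.D M * N) + reTrace (M * dMat J.D N)
    rw [← map_add, ← dMat_mul, reTrace_dMat]
  have adjoint := J.isInvariantForm_traceForm.isSkewAdjoint_ad (hPerpMat w) M N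
  simp only [Pi.neg_apply, LieDerivation.ad_apply_apply] at adjoint
  rw [Pi.neg_apply, covDer_apply, covDer_apply, map_add, LinearMap.add_apply, adjoint,
    integration_by_parts, neg_add, map_add, map_neg, map_neg]

theorem hPerpMat_comps (X : J.vf) : hPerpMat (J.comps X) = dMat X.1 (hPerpMat J.u) :=
  (dMat_hPerpMat _ _).symm

theorem hPerpMat_comps_lie (X Y : J.vf) : hPerpMat (J.comps ⁅X, Y⁆) =
    dMat X.1 (hPerpMat (J.comps Y)) - dMat Y.1 (hPerpMat (J.comps X)) := by
  simp only [hPerpMat_comps]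
  exact dMat_commutator _ _ _

theorem integral_pairing (z w : J.Field) (p : imH J.carrier)
    (V : Matrix (Fin (n - 1)) (Fin (n - 1)) ℍ[J.carrier]) :
    J.integral (pairing z w) =
      (-1 / 2 : ℝ) • J.traceForm (hPerpMat z) (hMat (w.1 : ℍ[J.carrier]) w.2 p V) := by
  rw [traceForm_apply, reTrace_hPerpMat_mul_hMat]
  change Submodule.Quotient.mk _ = (-1 / 2 : ℝ) • Submodule.Quotient.mk _
  rw [← Submodule.Quotient.mk_smul]
  congr 1
  module

theorem act_integral_pairing_sub (X Y : J.vf) (w : J.Field) (p : imH J.carrier)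
    (V : Matrix (Fin (n - 1)) (Fin (n - 1)) ℍ[J.carrier]) :
    J.act X (J.integral (pairing (J.comps Y) w)) - J.integral (pairing (J.comps ⁅X, Y⁆) w) =
      (-1 / 2 : ℝ) •
        (J.traceForm (dMat Y.1 (hPerpMat (J.comps X))) (hMat (w.1 : ℍ[J.carrier]) w.2 p V)
          + J.traceForm (hPerpMat (J.comps Y)) (dMat X.1 (hMat (w.1 : ℍ[J.carrier]) w.2 p V))) := by
  rw [J.integral_pairing _ w p V, J.integral_pairing _ w p V, map_smul, act_traceForm,
    hPerpMat_comps_lie, map_sub, LinearMap.sub_apply]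
  module

theorem act_lie (X Y : J.vf) (F : J.Functional) :
    J.act ⁅X, Y⁆ F = J.act X (J.act Y F) - J.act Y (J.act X F) := by
  obtain ⟨a, rfl⟩ := Submodule.mkQ_surjective _ F
  change J.integral (⁅X.1, Y.1⁆ a) = _
  rw [Derivation.commutator_apply]
  rfl

end JetAlgebra

namespace NonlocalOp

theorem isSymplectic_of_isPotential {P : NonlocalOp.{v} n} (a b : ℝ)
    (e : ∀ J : JetAlgebra.{v} n, Matrix (Idx n) (Idx n) ℍ[J.carrier])
    (he : ∀ (J : JetAlgebra.{v} n) (X : J.vf), dMat X.1 (e J) = 0)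
    (hP : ∀ (J : JetAlgebra.{v} n) (y w : J.Field), P J y w →
      ∃ (p : imH J.carrier) (V : Matrix (Fin (n - 1)) (Fin (n - 1)) ℍ[J.carrier])
        (m : Matrix (Idx n) (Idx n) ℍ[J.carrier]),
        IsPotential (covDer J.D J.u) (LieDerivation.ad ℝ _ (e J)) a b (hPerpMat y)
          (hMat (w.1 : ℍ[J.carrier]) w.2 p V) m) :
    IsSymplectic P := by
  intro J
  have hB := J.isInvariantForm_traceForm
  have hN := J.isSkewAdjoint_covDer J.u
  have hE := hB.isSkewAdjoint_ad (e J)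
  constructor
  · intro X₁ X₂ w₁ w₂ h₁ h₂
    obtain ⟨p₁, V₁, m₁, potential₁⟩ := hP J _ _ h₁
    obtain ⟨p₂, V₂, m₂, potential₂⟩ := hP J _ _ h₂
    rw [J.integral_pairing _ w₂ p₂ V₂, J.integral_pairing _ w₁ p₁ V₁,
      potential₁.form_skew hB hN hE potential₂, smul_neg]
  · intro X₁ X₂ X₃ w₁ w₂ w₃ h₁ h₂ h₃
    obtain ⟨p₁, V₁, m₁, potential₁⟩ := hP J _ _ h₁
    obtain ⟨p₂, V₂, m₂, potential₂⟩ := hP J _ _ h₂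
    obtain ⟨p₃, V₃, m₃, potential₃⟩ := hP J _ _ h₃
    have variation_covDer (X : J.vf) (M : Matrix (Idx n) (Idx n) ℍ[J.carrier]) :
        dMat X.1 (covDer J.D J.u M) =
          covDer J.D J.u (dMat X.1 M) + ⁅hPerpMat (J.comps X), M⁆ := by
      rw [dMat_covDer J.D (J.vf_comm X.1 X.2), J.hPerpMat_comps]
    have variation_ad (X : J.vf) (M : Matrix (Idx n) (Idx n) ℍ[J.carrier]) :
        dMat X.1 (LieDerivation.ad ℝ _ (e J) M) = LieDerivation.ad ℝ _ (e J) (dMat X.1 M) := by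
      rw [LieDerivation.ad_apply_apply, LieDerivation.ad_apply_apply, ← dMatDer_apply,
        LieDerivation.apply_lie_eq_add, dMatDer_apply, dMatDer_apply, he, zero_lie, add_zero]
    have closed := potential₁.form_closed hB hN hE potential₂ potential₃
      (X₁ := (dQLin X₁.1).mapMatrix) (X₂ := (dQLin X₂.1).mapMatrix)
      (X₃ := (dQLin X₃.1).mapMatrix) (variation_covDer X₁) (variation_covDer X₂)
      (variation_covDer X₃) (variation_ad X₁) (variation_ad X₂) (variation_ad X₃)
    rw [J.act_integral_pairing_sub X₁ X₂ w₃ p₃ V₃, J.act_integral_pairing_sub X₂ X₃ w₁ p₁ V₁,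
      J.act_integral_pairing_sub X₃ X₁ w₂ p₂ V₂, ← smul_add, ← smul_add]
    exact smul_eq_zero_of_right _ closed

theorem isHamiltonian_of_isSymplectic_inverse {P : NonlocalOp.{v} n}
    (hP : IsSymplectic P.inverse) : IsHamiltonian P := by
  intro J
  obtain ⟨skew, closed⟩ := hP J
  have poisson_eq_act (F G : HamFunctional P J) : poisson F G = J.act G.vec F.val :=
    (F.isVarDeriv G.vec).symm
  have form_eq_act (X : J.vf) (F : HamFunctional P J) :
      J.integral (pairing (J.comps X) F.grad) = J.act X F.val := by
    rw [F.isVarDeriv X, pairing_comm]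
  constructor
  · intro F G
    have skew_GF := skew G.vec F.vec G.grad F.grad G.vec_eq F.vec_eq
    rwa [form_eq_act, form_eq_act, ← poisson_eq_act, ← poisson_eq_act] at skew_GF
  · intro F G K
    have closed_GKF := closed G.vec K.vec F.vec G.grad K.grad F.grad G.vec_eq K.vec_eq F.vec_eq
    simp only [form_eq_act, JetAlgebra.act_lie] at closed_GKF
    simp only [poisson_eq_act]
    rw [← closed_GKF]
    abel

theorem IsSymplectic.comb {P Q : NonlocalOp.{v} n} (hP : IsSymplectic P) (hQ : IsSymplectic Q)
    (c₁ c₂ : ℝ) : IsSymplectic (comb c₁ c₂ P Q) := by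
  intro J
  have integral_pairing_comb (y v w : J.Field) : J.integral (pairing y (c₁ • v + c₂ • w)) =
      c₁ • J.integral (pairing y v) + c₂ • J.integral (pairing y w) := by
    simp only [pairing_comm y, J.integral_pairing _ y 0 0, hPerpMat_add, hPerpMat_smul, map_add,
      map_smul, LinearMap.add_apply, LinearMap.smul_apply]
    module
  constructor
  · rintro X₁ X₂ _ _ ⟨v₁, w₁, hv₁, hw₁, rfl⟩ ⟨v₂, w₂, hv₂, hw₂, rfl⟩
    rw [integral_pairing_comb, integral_pairing_comb, (hP J).1 X₁ X₂ v₁ v₂ hv₁ hv₂,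
      (hQ J).1 X₁ X₂ w₁ w₂ hw₁ hw₂]
    module
  · rintro X₁ X₂ X₃ _ _ _ ⟨v₁, w₁, hv₁, hw₁, rfl⟩ ⟨v₂, w₂, hv₂, hw₂, rfl⟩ ⟨v₃, w₃, hv₃, hw₃, rfl⟩
    have closed_P := (hP J).2 X₁ X₂ X₃ v₁ v₂ v₃ hv₁ hv₂ hv₃
    have closed_Q := (hQ J).2 X₁ X₂ X₃ w₁ w₂ w₃ hw₁ hw₂ hw₃
    simp only [integral_pairing_comb, map_add, map_smul]
    linear_combination (norm := module) c₁ • closed_P + c₂ • closed_Q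

end NonlocalOp

section Operators

open NonlocalOp

theorem isSymplectic_inverse_opH : IsSymplectic (opH.{v} n).inverse := by
  refine isSymplectic_of_isPotential 1 0 (fun _ => 0) (fun _ X => map_zero (dMatDer X.1))
    fun J y w h => ?_
  obtain ⟨p, V, -, hy⟩ := (hamRel_iff ..).1 h
  exact ⟨p, V, 0, by rw [hy]; module, by simp⟩

theorem isSymplectic_opJ : IsSymplectic (opJ.{v} n) := by
  refine isSymplectic_of_isPotential 0 1 (fun _ => mOne n _) (fun _ X => dMat_mOne X.1)
    fun J y w h => ?_
  obtain ⟨m, mv, hy, hm⟩ := (sympRel_iff ..).1 h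
  refine ⟨0, 0, mMat m mv, ?_, ?_⟩
  · rw [LieDerivation.ad_apply_apply, hy]
    module
  · rw [hm, hPerpMat_eq_hMat, LieDerivation.ad_apply_apply, Submodule.coe_zero]

theorem isSymplectic_inverse_comb_opH_inverse_opJ (c₁ c₂ : ℝ) :
    IsSymplectic (comb c₁ c₂ (opH.{v} n) (opJ.{v} n).inverse).inverse := by
  refine isSymplectic_of_isPotential c₁ c₂ (fun _ => mOne n _) (fun _ X => dMat_mOne X.1) ?_
  rintro J _ w ⟨y₁, y₂, hH, hJ, rfl⟩
  obtain ⟨p, V, -, hy₁⟩ := (hamRel_iff ..).1 hH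
  obtain ⟨m, mv, hy₂, hm⟩ := (sympRel_iff ..).1 hJ
  refine ⟨p, V, mMat m mv, ?_, ?_⟩
  · rw [hPerpMat_add, hPerpMat_smul, hPerpMat_smul, LieDerivation.ad_apply_apply, hy₁, hy₂]
  · rw [hm, LieDerivation.ad_apply_apply, lie_skew, lie_skew, lie_hPerpMat_mOne, lie_hMat_mOne]

theorem compatible_opH_opJ : Compatible (opH.{v} n) (opJ.{v} n) :=
  ⟨fun c₁ c₂ =>
      isHamiltonian_of_isSymplectic_inverse (isSymplectic_inverse_comb_opH_inverse_opJ c₁ c₂),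
    isSymplectic_inverse_opH.comb isSymplectic_opJ⟩

end Operators

end JetSpaces

section MaurerCartan

variable {A : Type v} [CommRing A] [Algebra ℝ A] {ι : Type*} [Fintype ι] [DecidableEq ι]
  {G : Matrix ι ι ℍ[A]} (D : Derivation ℝ A A)

theorem dMat_star_mul_of_mem_unitary (hG : G ∈ unitary (Matrix ι ι ℍ[A])) :
    dMat D (star G) * G = -(star G * dMat D G) := by
  have dMat_one : dMat D (1 : Matrix ι ι ℍ[A]) = 0 := by
    simpa using dMat_mul D (1 : Matrix ι ι ℍ[A]) 1
  rw [eq_neg_iff_add_eq_zero, ← dMat_mul, Unitary.star_mul_self_of_mem hG, dMat_one]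

theorem star_star_mul_dMat_of_mem_unitary (hG : G ∈ unitary (Matrix ι ι ℍ[A])) :
    star (star G * dMat D G) = -(star G * dMat D G) := by
  rw [← dMat_star_mul_of_mem_unitary D hG, star_mul, star_star]
  exact congr_arg (· * G) (dMat_conjTranspose D G).symm

theorem maurerCartan (hG : G ∈ unitary (Matrix ι ι ℍ[A])) {D E : Derivation ℝ A A}
    (hDE : ∀ a, D (E a) = E (D a)) :
    dMat D (star G * dMat E G) =
      dMat E (star G * dMat D G) + ⁅star G * dMat E G, star G * dMat D G⁆ := by
  have dMat_mul_dMat (D E : Derivation ℝ A A) : dMat D (star G) * dMat E G =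
      -(star G * dMat D G * (star G * dMat E G)) := by
    rw [← neg_mul, ← dMat_star_mul_of_mem_unitary D hG, mul_assoc, ← mul_assoc G,
      Unitary.mul_star_self_of_mem hG, one_mul]
  rw [Ring.lie_def, dMat_mul, dMat_mul, dMat_mul_dMat, dMat_mul_dMat, dMat_comm hDE]
  abel

end MaurerCartan

section ParallelFrames

variable {n : ℕ} {A : Type v} [CommRing A] [Algebra ℝ A]

theorem hMat_smul (c : ℝ) (w : ℍ[A]) (wv : Fin (n - 1) → ℍ[A]) (p : ℍ[A])
    (V : Matrix (Fin (n - 1)) (Fin (n - 1)) ℍ[A]) :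
    c • hMat w wv p V = hMat (c • w) (c • wv) (c • p) (c • V) := by
  ext1 (_ | _ | i) (_ | _ | j) <;> simp [hMat, Quaternion.star_smul]

theorem mMat_smul (c : ℝ) (m : ℍ[A]) (mv : Fin (n - 1) → ℍ[A]) :
    c • mMat m mv = mMat (c • m) (c • mv) := by
  ext1 (_ | _ | i) (_ | _ | j) <;> simp [mMat, Quaternion.star_smul]

variable {D : Derivation ℝ A A} {u : QField n A}

theorem dMat_add_lie_eq_hPerpMat_iff (c : ℝ) {w v : QField n A} {p : imH A}
    {V : Matrix (Fin (n - 1)) (Fin (n - 1)) ℍ[A]} (hV : V.conjTranspose = -V) {m : ℍ[A]}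
    {mv : Fin (n - 1) → ℍ[A]} :
    dMat D (hMat (w.1 : ℍ[A]) w.2 p V + mMat m mv)
        + ⁅c • mOne n A + hPerpMat u, hMat (w.1 : ℍ[A]) w.2 p V + mMat m mv⁆ = hPerpMat v ↔
      covDer D u (hMat (w.1 : ℍ[A]) w.2 p V) + c • ⁅mOne n A, mMat m mv⁆ = hPerpMat v ∧
        covDer D u (mMat m mv) + c • ⁅mOne n A, hMat (w.1 : ℍ[A]) w.2 p V⁆ = 0 := by
  have regroup (Ω μ : Matrix (Idx n) (Idx n) ℍ[A]) :
      dMat D (Ω + μ) + ⁅c • mOne n A + hPerpMat u, Ω + μ⁆ =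
        (covDer D u Ω + c • ⁅mOne n A, μ⁆) + (covDer D u μ + c • ⁅mOne n A, Ω⁆) := by
    rw [covDer_apply, covDer_apply, dMat_add, add_lie, smul_lie, lie_add, lie_add]
    module
  rw [regroup, ← lie_skew (mOne n A) (hMat _ _ _ _), lie_hMat_mOne, lie_mOne_mMat, covDer_apply,
    covDer_apply, lie_hPerpMat_hMat u w p hV, lie_hPerpMat_mMat, dMat_hMat, dMat_mMat, smul_neg,
    ← neg_smul, hMat_smul, mMat_smul]
  simp only [hMat_add_hMat, mMat_add_mMat]
  exact hMat_add_mMat_eq_hPerpMat_iff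

theorem hamRel_and_sympRel_of_zeroCurvature {s : ℝ} (hs : s ≠ 0)
    {F : Matrix (Idx n) (Idx n) ℍ[A]} (hF : F.conjTranspose = -F) {v h : QField n A}
    (hh : h = (s • (2 : ℝ) • (mPerp F).1, -(s • (mPerp F).2)))
    (hv : dMat D F + ⁅s⁻¹ • mOne n A + hPerpMat u, F⁆ = hPerpMat v) :
    hamRel D u (hPerp F) (v - (s * s)⁻¹ • h) ∧ sympRel D u h (hPerp F) := by
  obtain ⟨p, V, hV, F_eq⟩ := exists_eq_hMat_add_mMat hF
  set Ω := hMat ((hPerp F).1 : ℍ[A]) (hPerp F).2 p V with hΩ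
  set m := F (Sum.inl ()) (Sum.inr (Sum.inl ()))
  set mv := fun j => F (Sum.inl ()) (Sum.inr (Sum.inr j))
  have lie_mOne_μ : s • ⁅mOne n A, mMat m mv⁆ = hPerpMat h := by
    have two_smul_imPart : (2 : ℝ) • (imPart m : ℍ[A]) = m - star m := by
      rw [coe_imPart]
      module
    rw [hh, lie_mOne_mMat, hMat_smul, hPerpMat_eq_hMat, ← two_smul_imPart, smul_neg, smul_zero,
      smul_zero]
    rfl
  obtain ⟨curvature_𝔥, curvature_𝔪⟩ : covDer D u Ω + s⁻¹ • ⁅mOne n A, mMat m mv⁆ = hPerpMat v ∧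
      covDer D u (mMat m mv) + s⁻¹ • ⁅mOne n A, Ω⁆ = 0 := by
    rwa [F_eq, dMat_add_lie_eq_hPerpMat_iff _ hV] at hv
  constructor
  · refine (hamRel_iff ..).2 ⟨p, V, hV, ?_⟩
    rw [hPerpMat_sub, hPerpMat_smul, ← lie_mOne_μ, ← curvature_𝔥,
      smul_smul, mul_inv, inv_mul_cancel_right₀ hs]
    module
  · have lie_mOne_Ω : ⁅mOne n A, Ω⁆ = ⁅mOne n A, hPerpMat (hPerp F)⁆ := by
      rw [← lie_skew, hΩ, lie_hMat_mOne, ← lie_hPerpMat_mOne, lie_skew]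
    refine (sympRel_iff ..).2 ⟨s • m, s • mv, ?_, ?_⟩
    · rw [← mMat_smul, lie_smul, lie_mOne_μ]
    · rw [← mMat_smul, map_smul, eq_neg_of_add_eq_zero_left curvature_𝔪, smul_neg,
        smul_inv_smul₀ hs, lie_mOne_Ω]

end ParallelFrames

namespace SmoothFn

variable {U : TopologicalSpace.Opens (ℝ × ℝ)}

theorem dir_comm (e e' : ℝ × ℝ) (f : SmoothFn U) : dir e (dir e' f) = dir e' (dir e f) := by
  have smooth : ContDiffOn ℝ ∞ (ext f) (U : Set (ℝ × ℝ)) := f.2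
  have dir_dir (a b : ℝ × ℝ) (p : U) :
      (dir a (dir b f)).1 p = fderiv ℝ (fderiv ℝ (ext f)) p a b := by
    have differentiable_fderiv : DifferentiableAt ℝ (fderiv ℝ (ext f)) p :=
      (((contDiffOn_infty_iff_fderiv_of_isOpen U.isOpen).1 smooth).2.contDiffAt
        (U.isOpen.mem_nhds p.2)).differentiableAt (by simp)
    change fderiv ℝ (ext (dir b f)) p a = _
    rw [(eventuallyEq_ext (f := dir b f) (g := fun q => fderiv ℝ (ext f) q b)
      (fun _ => rfl) p).fderiv_eq,
      fderiv_clm_apply differentiable_fderiv (differentiableAt_const b)]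
    simp
  apply Subtype.ext
  funext p
  rw [dir_dir, dir_dir]
  exact ((smooth.contDiffAt (U.isOpen.mem_nhds p.2)).isSymmSndFDerivAt
    (by rw [minSmoothness_of_isRCLikeNormedField]; exact ENat.LEInfty.out)).eq e e'

@[simp]
theorem evalQ_re (p : U) (a : ℍ[SmoothFn U]) : (evalQ p a).re = a.re.1 p := rfl

@[simp]
theorem evalQ_imI (p : U) (a : ℍ[SmoothFn U]) : (evalQ p a).imI = a.imI.1 p := rfl

@[simp]
theorem evalQ_imJ (p : U) (a : ℍ[SmoothFn U]) : (evalQ p a).imJ = a.imJ.1 p := rfl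

@[simp]
theorem evalQ_imK (p : U) (a : ℍ[SmoothFn U]) : (evalQ p a).imK = a.imK.1 p := rfl

/-- `evalQ p` as a ring homomorphism. -/
@[simps]
def evalQHom (p : U) : ℍ[SmoothFn U] →+* ℍ[ℝ] where
  toFun := evalQ p
  map_zero' := rfl
  map_one' := rfl
  map_add' _ _ := rfl
  map_mul' a b := by ext <;> simp

theorem evalQ_star (p : U) (a : ℍ[SmoothFn U]) : evalQ p (star a) = star (evalQ p a) := by
  ext <;> simp

theorem evalQ_ext {a b : ℍ[SmoothFn U]} (h : ∀ p, evalQ p a = evalQ p b) : a = b := by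
  ext p
  exacts [congr_arg QuaternionAlgebra.re (h p), congr_arg QuaternionAlgebra.imI (h p),
    congr_arg QuaternionAlgebra.imJ (h p), congr_arg QuaternionAlgebra.imK (h p)]

end SmoothFn

namespace MovingFrame

variable {n : ℕ} {U : TopologicalSpace.Opens (ℝ × ℝ)} {γ : U → HP n} (g : MovingFrame γ)

theorem mat_mem_unitary : g.mat ∈ unitary (Matrix (Idx n) (Idx n) ℍ[SmoothFn U]) := by
  have eq_of_map_evalQHom {M N : Matrix (Idx n) (Idx n) ℍ[SmoothFn U]}
      (h : ∀ p, M.map (SmoothFn.evalQHom p) = N.map (SmoothFn.evalQHom p)) : M = N :=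
    Matrix.ext fun i j => SmoothFn.evalQ_ext fun p => congr_fun₂ (h p) i j
  have map_mat (p : U) : g.mat.map (SmoothFn.evalQHom p) = (g.lift p).1 :=
    Matrix.ext fun i j => (g.lift_eq p i j).symm
  have map_star_mat (p : U) : (star g.mat).map (SmoothFn.evalQHom p) = star (g.lift p).1 := by
    rw [← map_mat]
    exact Matrix.conjTranspose_map _ (SmoothFn.evalQ_star p)
  rw [Unitary.mem_iff]
  constructor <;> refine eq_of_map_evalQHom fun p => ?_ <;>
    rw [Matrix.map_mul, map_mat, map_star_mat, Matrix.map_one _ (map_zero _) (map_one _)]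
  exacts [Unitary.coe_star_mul_self _, Unitary.coe_mul_star_self _]

theorem zeroCurvature (hg : g.IsParallel) :
    dMat (SmoothFn.dx U) g.formT
        + ⁅(Real.sqrt (chi n))⁻¹ • mOne n (SmoothFn U) + hPerpMat g.u, g.formT⁆ =
      hPerpMat (dField (SmoothFn.dt U) g.u) := by
  have structure_equation : dMat (SmoothFn.dt U) g.formX =
      dMat (SmoothFn.dx U) g.formT + ⁅g.formX, g.formT⁆ :=
    maurerCartan g.mat_mem_unitary (SmoothFn.dir_comm _ _)
  rw [hg, dMat_add, dMat_smul, dMat_mOne, smul_zero, zero_add, dMat_hPerpMat] at structure_equation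
  exact structure_equation.symm

theorem operatorForm_of_isParallel (hg : g.IsParallel) : g.OperatorForm := by
  have chi_pos : 0 < chi n := by
    unfold chi
    positivity
  obtain ⟨ham, symp⟩ := hamRel_and_sympRel_of_zeroCurvature (Real.sqrt_pos.2 chi_pos).ne'
    (star_star_mul_dMat_of_mem_unitary _ g.mat_mem_unitary) (h := g.h) rfl
    (g.zeroCurvature hg)
  rw [Real.mul_self_sqrt chi_pos.le] at ham
  exact ⟨_, ham, (sub_add_cancel _ _).symm, symp⟩

end MovingFrame

end

theorem mainTheorem1 (n : ℕ) (hn : 1 ≤ n) :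
    (∀ (U : TopologicalSpace.Opens (ℝ × ℝ)) (γ : U → HP n) (g : MovingFrame γ),
      g.IsParallel → g.OperatorForm) ∧
    NonlocalOp.IsHamiltonian (opH.{v} n) ∧
    NonlocalOp.IsSymplectic (opJ.{v} n) ∧
    NonlocalOp.Compatible (opH.{v} n) (opJ.{v} n) :=
  ⟨fun _ _ g => g.operatorForm_of_isParallel,
    NonlocalOp.isHamiltonian_of_isSymplectic_inverse isSymplectic_inverse_opH,
    isSymplectic_opJ, compatible_opH_opJ⟩
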